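/- Let $X$ be a locally compact Hausdorff space. All Banach algebras are complex and not necessarily unital. A $C_0(X)$-Banach algebra is a Banach algebra $A$ that is also a Banach $C_0(X)$-module (so $\|\chi a\|\le\|\chi\|_\infty\|a\|$) which is non-degenerate (the linear span of $C_0(X)A$ is dense in $A$), such that the multiplication of $A$ is $C_0(X)$-bilinear. For $x\in X$ its fibre is the quotient Banach algebra $A_x=A/\overline{\mathrm{span}}\,(C_0(X\setminus\{x\})A)$, with quotient map $a\mapsto a_x$; here $C_0(X\setminus\{x\})$ is the ideal of all $\chi\in C_0(X)$ with $\chi(x)=0$. A contractive $C_0(X)$-linear homomorphism $\varphi\colon A\to A'$ of $C_0(X)$-Banach algebras induces homomorphisms $\varphi_x\colon A_x\to A'_x$, $a_x\mapsto\varphi(a)_x$. A contractive homomorphism $\varphi\colon A\to A'$ of Banach algebras is called isoradial if $\rho_{A'}(\varphi(a))=\rho_A(a)$ for all $a\in A$, where $\rho$ denotes the spectral radius (computed in the unitalisation), and full if it is isoradial and has dense range. The Gelfand transform $\hat A$ of $A$ is the $C_0(X)$-Banach algebra, with pointwise operations and supremum norm, of all sections $\xi\in\prod_{x\in X}A_x$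 such that $x\mapsto\|\xi(x)\|$ vanishes at infinity and such that for every $x\in X$ and $\varepsilon>0$ there are $a\in A$ and a neighbourhood $V$ of $x$ with $\|\xi(v)-a_v\|\le\varepsilon$ for all $v\in V$; the canonical homomorphism $\iota_A\colon A\to\hat A$ sends $a$ to $x\mapsto a_x$. $K_*=(K_0,K_1)$ denotes the topological K-theory of Banach algebras: $K_i(A)=\ker(K_i(A^+)\to K_i(\mathbb C))$ for the unitalisation $A^+$, where for unital $R$ the group $K_0(R)$ is the Grothendieck group of equivalence classes of idempotent matrices over $R$, and $K_1(R)=\varinjlim_n GL_n(R)/GL_n(R)_0$, with $GL_n(R)_0$ the connected component of the identity. (1) Assume that $X$ is second countable. Let $A$ and $A'$ be $C_0(X)$-Banach algebras and let $\varphi\colon A\to A'$ be a contractive $C_0(X)$-linear homomorphism such that $\varphi_x\colon A_x\to A'_x$ is isoradial for every $x\in X$. Then $\varphi$ is isoradial. If, moreover, $\varphi_x$ has dense image for every $x\in X$, then $\varphi_*\colon K_*(A)\to K_*(A')$ is an isomorphism. (2) Let $A$ be a $C_0(X)$-Banach algebra. Then the canonical homomorphism $\iota_A\colon A\to\hat A$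 is full, and it induces an isomorphism $K_*(A)\cong K_*(\hat A)$. -/

import Mathlib

open scoped ZeroAtInfty ENNReal Topology

/-! ### `C₀(X)`-Banach algebras -/

/-- A `C₀(X)`-Banach algebra structure on a complex (possibly non-unital) Banach algebra `A`:
a contractive, non-degenerate module structure over the Banach algebra `C₀(X)` for which the
multiplication of `A` is `C₀(X)`-bilinear. -/
class C0BanachAlgebra (X A : Type*) [TopologicalSpace X] [NonUnitalNormedRing A]
    [NormedSpace ℂ A] extends SMul C₀(X, ℂ) A where
  smul_add' (χ : C₀(X, ℂ)) (a b : A) : χ • (a + b) = χ • a + χ • b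
  add_smul' (χ ψ : C₀(X, ℂ)) (a : A) : (χ + ψ) • a = χ • a + ψ • a
  mul_smul' (χ ψ : C₀(X, ℂ)) (a : A) : (χ * ψ) • a = χ • (ψ • a)
  smul_smul_left' (z : ℂ) (χ : C₀(X, ℂ)) (a : A) : (z • χ) • a = z • (χ • a)
  smul_smul_right' (z : ℂ) (χ : C₀(X, ℂ)) (a : A) : χ • (z • a) = z • (χ • a)
  norm_smul_le' (χ : C₀(X, ℂ)) (a : A) : ‖χ • a‖ ≤ ‖χ‖ * ‖a‖
  smul_mul' (χ : C₀(X, ℂ)) (a b : A) : χ • (a * b) = (χ • a) * b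
  mul_smul_comm' (χ : C₀(X, ℂ)) (a b : A) : χ • (a * b) = a * (χ • b)
  nondegenerate' : Dense (Submodule.span ℂ {b : A | ∃ (χ : C₀(X, ℂ)) (a : A), b = χ • a} : Set A)

namespace C0BanachAlgebra


section Fibre

variable (X A : Type*) [TopologicalSpace X] [NonUnitalNormedRing A] [NormedSpace ℂ A]
  [IsScalarTower ℂ A A] [SMulCommClass ℂ A A] [C0BanachAlgebra X A]

/-- The closed ideal `C₀(X ∖ {x}) A` of `A`, where `C₀(X ∖ {x})` is identified with the functions
in `C₀(X)` that vanish at `x`. -/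
def fibreIdeal (x : X) : Submodule ℂ A :=
  (Submodule.span ℂ {b : A | ∃ (χ : C₀(X, ℂ)) (a : A), χ x = 0 ∧ b = χ • a}).topologicalClosure

instance (x : X) : IsClosed (fibreIdeal X A x : Set A) := Submodule.isClosed_topologicalClosure _

theorem closure_span_le_comap {B C : Type*} [NormedAddCommGroup B] [NormedSpace ℂ B]
    [NormedAddCommGroup C] [NormedSpace ℂ C] (s : Set B) (t : Submodule ℂ C)
    (ht : IsClosed (t : Set C)) (f : B →ₗ[ℂ] C) (hf : Continuous f) (h : ∀ b ∈ s, f b ∈ t) :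
    (Submodule.span ℂ s).topologicalClosure ≤ t.comap f := by
  refine Submodule.topologicalClosure_minimal _ (Submodule.span_le.2 h) ?_
  exact ht.preimage hf

theorem smul_mem_fibreIdeal {x : X} {χ : C₀(X, ℂ)} (h : χ x = 0) (a : A) :
    χ • a ∈ fibreIdeal X A x :=
  Submodule.le_topologicalClosure _ (Submodule.subset_span ⟨χ, a, h, rfl⟩)

theorem mul_mem_fibreIdeal_left {x : X} (a : A) {b : A} (hb : b ∈ fibreIdeal X A x) :
    a * b ∈ fibreIdeal X A x := by
  refine closure_span_le_comap _ (fibreIdeal X A x) inferInstance (LinearMap.mulLeft ℂ a)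
    (continuous_const_mul a) ?_ hb
  rintro _ ⟨χ, c, h, rfl⟩
  rw [LinearMap.mulLeft_apply, ← mul_smul_comm']
  exact smul_mem_fibreIdeal X A h _

theorem mul_mem_fibreIdeal_right {x : X} {a : A} (b : A) (ha : a ∈ fibreIdeal X A x) :
    a * b ∈ fibreIdeal X A x := by
  refine closure_span_le_comap _ (fibreIdeal X A x) inferInstance (LinearMap.mulRight ℂ b)
    (continuous_mul_const b) ?_ ha
  rintro _ ⟨χ, c, h, rfl⟩
  rw [LinearMap.mulRight_apply, ← smul_mul']
  exact smul_mem_fibreIdeal X A h _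

/-- The fibre `A_x = A / C₀(X ∖ {x}) A` with the quotient norm. -/
def Fibre (x : X) : Type _ := A ⧸ fibreIdeal X A x

noncomputable instance (x : X) : NormedAddCommGroup (Fibre X A x) :=
  inferInstanceAs (NormedAddCommGroup (A ⧸ fibreIdeal X A x))

noncomputable instance (x : X) : NormedSpace ℂ (Fibre X A x) :=
  inferInstanceAs (NormedSpace ℂ (A ⧸ fibreIdeal X A x))

instance [CompleteSpace A] (x : X) : CompleteSpace (Fibre X A x) :=
  inferInstanceAs (CompleteSpace (A ⧸ fibreIdeal X A x))

/-- The quotient map `a ↦ a_x`. -/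
def fibreMk (x : X) : A →ₗ[ℂ] Fibre X A x := (fibreIdeal X A x).mkQ

instance (x : X) : Mul (Fibre X A x) where
  mul := Quotient.map₂ (· * ·) (by
    intro a a' h b b' h'
    replace h : a - a' ∈ fibreIdeal X A x := (Submodule.quotientRel_def _).1 h
    replace h' : b - b' ∈ fibreIdeal X A x := (Submodule.quotientRel_def _).1 h'
    refine (Submodule.quotientRel_def _).2 ?_
    have : a * b - a' * b' = (a - a') * b + a' * (b - b') := by noncomm_ring
    rw [this]
    exact add_mem (mul_mem_fibreIdeal_right X A b h) (mul_mem_fibreIdeal_left X A a' h'))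

theorem fibreMk_mul (x : X) (a b : A) : fibreMk X A x (a * b) = fibreMk X A x a * fibreMk X A x b :=
  rfl

theorem fibreMk_surjective (x : X) : Function.Surjective (fibreMk X A x) :=
  (fibreIdeal X A x).mkQ_surjective

theorem norm_fibreMk_le (x : X) (a : A) : ‖fibreMk X A x a‖ ≤ ‖a‖ :=
  Submodule.Quotient.norm_mk_le _ a

noncomputable instance (x : X) : NonUnitalNormedRing (Fibre X A x) where
  __ := (inferInstance : NormedAddCommGroup (Fibre X A x))
  left_distrib := by
    intro p q r
    obtain ⟨a, rfl⟩ := fibreMk_surjective X A x p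
    obtain ⟨b, rfl⟩ := fibreMk_surjective X A x q
    obtain ⟨c, rfl⟩ := fibreMk_surjective X A x r
    simp only [← fibreMk_mul, ← map_add, mul_add]
  right_distrib := by
    intro p q r
    obtain ⟨a, rfl⟩ := fibreMk_surjective X A x p
    obtain ⟨b, rfl⟩ := fibreMk_surjective X A x q
    obtain ⟨c, rfl⟩ := fibreMk_surjective X A x r
    simp only [← fibreMk_mul, ← map_add, add_mul]
  zero_mul := by
    intro p
    obtain ⟨a, rfl⟩ := fibreMk_surjective X A x p
    rw [← map_zero (fibreMk X A x), ← fibreMk_mul, zero_mul]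
  mul_zero := by
    intro p
    obtain ⟨a, rfl⟩ := fibreMk_surjective X A x p
    rw [← map_zero (fibreMk X A x), ← fibreMk_mul, mul_zero]
  mul_assoc := by
    intro p q r
    obtain ⟨a, rfl⟩ := fibreMk_surjective X A x p
    obtain ⟨b, rfl⟩ := fibreMk_surjective X A x q
    obtain ⟨c, rfl⟩ := fibreMk_surjective X A x r
    simp only [← fibreMk_mul, mul_assoc]
  norm_mul_le := by
    intro p q
    have hlim : Filter.Tendsto (fun ε : ℝ => (‖p‖ + ε) * (‖q‖ + ε)) (𝓝[>] 0)
        (𝓝 (‖p‖ * ‖q‖)) := by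
      have : Continuous fun ε : ℝ => (‖p‖ + ε) * (‖q‖ + ε) := by fun_prop
      simpa using (this.tendsto 0).mono_left nhdsWithin_le_nhds
    refine ge_of_tendsto hlim ?_
    filter_upwards [self_mem_nhdsWithin] with ε hε
    obtain ⟨a, rfl, ha⟩ : ∃ a, fibreMk X A x a = p ∧ ‖a‖ < ‖p‖ + ε :=
      Submodule.Quotient.norm_mk_lt p hε
    obtain ⟨b, rfl, hb⟩ : ∃ b, fibreMk X A x b = q ∧ ‖b‖ < ‖q‖ + ε :=
      Submodule.Quotient.norm_mk_lt q hε
    calc ‖fibreMk X A x a * fibreMk X A x b‖ = ‖fibreMk X A x (a * b)‖ := rfl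
      _ ≤ ‖a * b‖ := norm_fibreMk_le X A x _
      _ ≤ ‖a‖ * ‖b‖ := norm_mul_le a b
      _ ≤ _ := mul_le_mul ha.le hb.le (norm_nonneg _) ((norm_nonneg a).trans ha.le)

instance (x : X) : IsScalarTower ℂ (Fibre X A x) (Fibre X A x) where
  smul_assoc z p q := by
    obtain ⟨a, rfl⟩ := fibreMk_surjective X A x p
    obtain ⟨b, rfl⟩ := fibreMk_surjective X A x q
    simp only [smul_eq_mul, ← fibreMk_mul, ← map_smul, smul_mul_assoc]

instance (x : X) : SMulCommClass ℂ (Fibre X A x) (Fibre X A x) where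
  smul_comm z p q := by
    obtain ⟨a, rfl⟩ := fibreMk_surjective X A x p
    obtain ⟨b, rfl⟩ := fibreMk_surjective X A x q
    simp only [smul_eq_mul, ← fibreMk_mul, ← map_smul, mul_smul_comm]

theorem sub_smul_mem_fibreIdeal (x : X) (χ : C₀(X, ℂ)) (a : A) :
    χ • a - χ x • a ∈ fibreIdeal X A x := by
  let f : A →ₗ[ℂ] A :=
    { toFun := fun a => χ • a - χ x • a
      map_add' := fun a b => by rw [smul_add', smul_add]; abel
      map_smul' := fun z a => by
        rw [smul_smul_right', smul_comm (χ x) z a, ← smul_sub]; rfl }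
  have hf : Continuous f := by
    refine AddMonoidHomClass.continuous_of_bound f (‖χ‖ + ‖χ x‖) fun a => ?_
    calc ‖χ • a - χ x • a‖ ≤ ‖χ • a‖ + ‖χ x • a‖ := norm_sub_le _ _
      _ ≤ ‖χ‖ * ‖a‖ + ‖χ x‖ * ‖a‖ := add_le_add (norm_smul_le' χ a) (norm_smul_le _ _)
      _ = _ := by ring
  have h := closure_span_le_comap
    {b : A | ∃ (χ : C₀(X, ℂ)) (a : A), b = χ • a} (fibreIdeal X A x) inferInstance f hf (by
      rintro _ ⟨ψ, b, rfl⟩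
      have : f (ψ • b) = (χ * ψ - χ x • ψ) • b := by
        rw [sub_eq_add_neg, add_smul', mul_smul', ← neg_one_smul ℂ (χ x • ψ), smul_smul_left',
          smul_smul_left', neg_one_smul, ← sub_eq_add_neg]
        rfl
      rw [this]
      exact smul_mem_fibreIdeal X A (by simp) _)
  refine h ?_
  exact nondegenerate' (X := X) a

theorem fibreMk_smul (x : X) (χ : C₀(X, ℂ)) (a : A) :
    fibreMk X A x (χ • a) = χ x • fibreMk X A x a := by
  rw [← map_smul, ← sub_eq_zero, ← map_sub]
  exact (Submodule.Quotient.mk_eq_zero _).2 (sub_smul_mem_fibreIdeal X A x χ a)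

end Fibre

section Gelfand

variable (X A : Type*) [TopologicalSpace X] [NonUnitalNormedRing A] [NormedSpace ℂ A]
  [IsScalarTower ℂ A A] [SMulCommClass ℂ A A] [C0BanachAlgebra X A]

/-- Continuous sections of the upper semi-continuous field `(A_x)_{x ∈ X}`: those which are locally
uniform limits of sections of the form `x ↦ a_x` with `a ∈ A`. -/
def IsContSection (ξ : ∀ x : X, Fibre X A x) : Prop :=
  ∀ x : X, ∀ ε > 0, ∃ a : A, ∀ᶠ v in 𝓝 x, ‖ξ v - fibreMk X A v a‖ ≤ ε

/-- Sections whose norm vanishes at infinity. -/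
def VanishesAtInfty (ξ : ∀ x : X, Fibre X A x) : Prop :=
  Filter.Tendsto (fun x => ‖ξ x‖) (Filter.cocompact X) (𝓝 0)

variable {X A} in
theorem IsContSection.eventually_bounded {ξ : ∀ x : X, Fibre X A x} (h : IsContSection X A ξ)
    (x : X) : ∃ C > 0, ∀ᶠ v in 𝓝 x, ‖ξ v‖ ≤ C := by
  obtain ⟨a, ha⟩ := h x 1 one_pos
  refine ⟨1 + ‖a‖, by positivity, ha.mono fun v hv => ?_⟩
  calc ‖ξ v‖ = ‖(ξ v - fibreMk X A v a) + fibreMk X A v a‖ := by rw [sub_add_cancel]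
    _ ≤ _ := (norm_add_le _ _).trans (add_le_add hv (norm_fibreMk_le X A v a))

/-- Continuous sections that vanish at infinity are automatically bounded, so that nothing is lost
by working inside the `ℓ^∞`-product of the fibres below. -/
theorem bounded_of_section {ξ : ∀ x : X, Fibre X A x} (h : IsContSection X A ξ)
    (h0 : VanishesAtInfty X A ξ) : Memℓp ξ ∞ := by
  obtain ⟨K, hK, hK'⟩ := Filter.mem_cocompact.1 (h0.eventually (gt_mem_nhds one_pos))
  choose C hC hC' using fun x => h.eventually_bounded x
  obtain ⟨t, -, ht⟩ := hK.elim_nhds_subcover (fun x => {v | ‖ξ v‖ ≤ C x}) (fun x _ => hC' x)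
  refine memℓp_infty ⟨1 + ∑ x ∈ t, C x, ?_⟩
  rintro _ ⟨v, rfl⟩
  have hs : 0 ≤ ∑ x ∈ t, C x := Finset.sum_nonneg fun x _ => (hC x).le
  by_cases hv : v ∈ K
  · obtain ⟨x, hx, hvx⟩ := Set.mem_iUnion₂.1 (ht hv)
    have h1 : C x ≤ ∑ x ∈ t, C x := Finset.single_le_sum (fun x _ => (hC x).le) hx
    have h2 : ‖ξ v‖ ≤ C x := hvx
    change ‖ξ v‖ ≤ _
    linarith
  · have h2 : ‖ξ v‖ < 1 := hK' hv
    change ‖ξ v‖ ≤ _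
    linarith

/-- `Γ₀(X, (A_x)_x)` as a subalgebra of the `ℓ^∞`-product of the fibres: continuous sections
vanishing at infinity, with pointwise operations and the supremum norm. -/
def gelfandSubalgebra : NonUnitalSubalgebra ℂ (lp (fun x : X => Fibre X A x) ∞) where
  carrier := {ξ | IsContSection X A ξ ∧ VanishesAtInfty X A ξ}
  zero_mem' := by
    refine ⟨fun x ε hε => ⟨0, .of_forall fun v => ?_⟩, ?_⟩
    · simpa using hε.le
    · simpa [VanishesAtInfty] using tendsto_const_nhds
  add_mem' := by
    rintro ξ η ⟨hξ, hξ0⟩ ⟨hη, hη0⟩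
    refine ⟨fun x ε hε => ?_, ?_⟩
    · obtain ⟨a, ha⟩ := hξ x (ε / 2) (by positivity)
      obtain ⟨b, hb⟩ := hη x (ε / 2) (by positivity)
      refine ⟨a + b, ?_⟩
      filter_upwards [ha, hb] with v hav hbv
      rw [lp.coeFn_add, Pi.add_apply, map_add, add_sub_add_comm]
      exact (norm_add_le _ _).trans (by linarith)
    · refine squeeze_zero (fun _ => norm_nonneg _) (fun v => norm_add_le _ _) ?_
      simpa using hξ0.add hη0
  mul_mem' := by
    rintro ξ η ⟨hξ, hξ0⟩ ⟨hη, hη0⟩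
    refine ⟨fun x ε hε => ?_, ?_⟩
    · obtain ⟨C, hC, hC'⟩ := hη.eventually_bounded x
      obtain ⟨a, ha⟩ := hξ x (ε / 2 / C) (by positivity)
      obtain ⟨b, hb⟩ := hη x (ε / 2 / (‖a‖ + 1)) (by positivity)
      refine ⟨a * b, ?_⟩
      filter_upwards [ha, hb, hC'] with v hav hbv hCv
      rw [lp.infty_coeFn_mul, Pi.mul_apply, fibreMk_mul]
      have e : ξ v * η v - fibreMk X A v a * fibreMk X A v b =
          (ξ v - fibreMk X A v a) * η v + fibreMk X A v a * (η v - fibreMk X A v b) := by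
        noncomm_ring
      rw [e]
      have h1 : ‖(ξ v - fibreMk X A v a) * η v‖ ≤ ε / 2 / C * C :=
        norm_mul_le_of_le hav hCv
      have h2 : ‖fibreMk X A v a * (η v - fibreMk X A v b)‖ ≤ (‖a‖ + 1) * (ε / 2 / (‖a‖ + 1)) :=
        norm_mul_le_of_le ((norm_fibreMk_le X A v a).trans (by linarith)) hbv
      rw [div_mul_cancel₀ _ hC.ne'] at h1
      rw [mul_div_cancel₀ _ (by positivity)] at h2
      exact (norm_add_le _ _).trans (by linarith)
    · refine squeeze_zero (fun _ => norm_nonneg _) (fun v => norm_mul_le _ _) ?_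
      simpa using hξ0.mul hη0
  smul_mem' := by
    rintro z ξ ⟨hξ, hξ0⟩
    refine ⟨fun x ε hε => ?_, ?_⟩
    · obtain ⟨a, ha⟩ := hξ x (ε / (‖z‖ + 1)) (by positivity)
      refine ⟨z • a, ?_⟩
      filter_upwards [ha] with v hav
      rw [lp.coeFn_smul, Pi.smul_apply, map_smul, ← smul_sub, norm_smul]
      calc ‖z‖ * ‖ξ v - fibreMk X A v a‖ ≤ (‖z‖ + 1) * (ε / (‖z‖ + 1)) := by
            gcongr
            linarith
        _ = ε := mul_div_cancel₀ _ (by positivity)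
    · have := hξ0.const_mul ‖z‖
      rw [mul_zero] at this
      refine this.congr fun v => ?_
      rw [lp.coeFn_smul, Pi.smul_apply, norm_smul]

/-- The Gelfand transform `Â = Γ₀(X, (A_x)_x)` of `A`. -/
def Gelfand : Type _ := gelfandSubalgebra X A

noncomputable instance : NonUnitalNormedRing (Gelfand X A) :=
  inferInstanceAs (NonUnitalNormedRing (gelfandSubalgebra X A))

noncomputable instance : NormedSpace ℂ (Gelfand X A) :=
  inferInstanceAs (NormedSpace ℂ (gelfandSubalgebra X A).toSubmodule)

instance : IsScalarTower ℂ (Gelfand X A) (Gelfand X A) :=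
  inferInstanceAs (IsScalarTower ℂ (gelfandSubalgebra X A) (gelfandSubalgebra X A))

instance : SMulCommClass ℂ (Gelfand X A) (Gelfand X A) :=
  inferInstanceAs (SMulCommClass ℂ (gelfandSubalgebra X A) (gelfandSubalgebra X A))

variable {X A} in
theorem norm_section_le (ξ : lp (fun x : X => Fibre X A x) ∞) (x : X) : ‖ξ x‖ ≤ ‖ξ‖ :=
  lp.norm_apply_le_norm ENNReal.top_ne_zero ξ x

theorem isClosed_gelfandSubalgebra :
    IsClosed (gelfandSubalgebra X A : Set (lp (fun x : X => Fibre X A x) ∞)) := by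
  refine isClosed_of_closure_subset fun ξ hξ => ⟨fun x ε hε => ?_, ?_⟩
  · obtain ⟨η, hη, hd⟩ := Metric.mem_closure_iff.1 hξ (ε / 2) (by positivity)
    obtain ⟨a, ha⟩ := hη.1 x (ε / 2) (by positivity)
    refine ⟨a, ha.mono fun v hv => ?_⟩
    have h1 : ‖ξ v - η v‖ ≤ ‖ξ - η‖ := norm_section_le (ξ - η) v
    rw [dist_eq_norm] at hd
    calc ‖ξ v - fibreMk X A v a‖ = ‖(ξ v - η v) + (η v - fibreMk X A v a)‖ := by
          rw [sub_add_sub_cancel]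
      _ ≤ ε := (norm_add_le _ _).trans (by linarith)
  · refine Metric.tendsto_nhds.2 fun ε hε => ?_
    obtain ⟨η, hη, hd⟩ := Metric.mem_closure_iff.1 hξ (ε / 2) (by positivity)
    have h0 := Metric.tendsto_nhds.1 hη.2 (ε / 2) (by positivity)
    filter_upwards [h0] with v hv
    have h1 : ‖ξ v - η v‖ ≤ ‖ξ - η‖ := norm_section_le (ξ - η) v
    rw [dist_eq_norm] at hd
    rw [dist_zero_right, norm_norm] at hv ⊢
    calc ‖ξ v‖ = ‖(ξ v - η v) + η v‖ := by rw [sub_add_cancel]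
      _ < ε := (norm_add_le _ _).trans_lt (by linarith)

instance [CompleteSpace A] : CompleteSpace (Gelfand X A) :=
  (isClosed_gelfandSubalgebra X A).completeSpace_coe

variable {X A} in
theorem smul_section_mem (χ : C₀(X, ℂ)) {ξ : ∀ x : X, Fibre X A x} (h : IsContSection X A ξ)
    (h0 : VanishesAtInfty X A ξ) :
    IsContSection X A (fun x => χ x • ξ x) ∧ VanishesAtInfty X A (fun x => χ x • ξ x) := by
  refine ⟨fun x ε hε => ?_, ?_⟩
  · obtain ⟨C, hC, hC'⟩ := h.eventually_bounded x
    obtain ⟨a, ha⟩ := h x (ε / 2 / (‖χ x‖ + 1)) (by positivity)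
    refine ⟨χ x • a, ?_⟩
    have hχ : ∀ᶠ v in 𝓝 x, dist (χ v) (χ x) < ε / 2 / C :=
      Metric.tendsto_nhds.1 (map_continuous χ).continuousAt _ (by positivity)
    filter_upwards [hC', ha, hχ] with v h1 h2 h3
    have e : χ v • ξ v - fibreMk X A v (χ x • a) =
        (χ v - χ x) • ξ v + χ x • (ξ v - fibreMk X A v a) := by
      rw [map_smul, sub_smul, smul_sub]; abel
    rw [dist_eq_norm] at h3
    have h4 : ‖(χ v - χ x) • ξ v‖ ≤ ε / 2 / C * C := by
      rw [norm_smul]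
      gcongr
    have h5 : ‖χ x • (ξ v - fibreMk X A v a)‖ ≤ (‖χ x‖ + 1) * (ε / 2 / (‖χ x‖ + 1)) := by
      rw [norm_smul]
      gcongr
      linarith
    rw [div_mul_cancel₀ _ hC.ne'] at h4
    rw [mul_div_cancel₀ _ (by positivity)] at h5
    rw [e]
    exact (norm_add_le _ _).trans (by linarith)
  · have := h0.const_mul ‖χ‖
    rw [mul_zero] at this
    refine squeeze_zero (fun _ => norm_nonneg _) (fun v => ?_) this
    rw [norm_smul]
    gcongr
    exact χ.toBCF.norm_coe_le_norm v

/-- The pointwise action `(χ ξ)(x) = χ(x) ξ(x)` of `C₀(X)` on the Gelfand transform. -/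
noncomputable instance : SMul C₀(X, ℂ) (Gelfand X A) where
  smul χ ξ := ⟨⟨fun x => χ x • ξ.1 x, bounded_of_section X A (smul_section_mem χ ξ.2.1 ξ.2.2).1
    (smul_section_mem χ ξ.2.1 ξ.2.2).2⟩, smul_section_mem χ ξ.2.1 ξ.2.2⟩

variable {X A} in
theorem Gelfand.ext' {ξ η : Gelfand X A} (h : ∀ x, ξ.1 x = η.1 x) : ξ = η :=
  Subtype.ext (lp.ext (funext h))

variable {X A} in
theorem Gelfand.norm_le {ξ : Gelfand X A} {C : ℝ} (hC : 0 ≤ C) (h : ∀ x, ‖ξ.1 x‖ ≤ C) :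
    ‖ξ‖ ≤ C :=
  lp.norm_le_of_forall_le hC h

noncomputable instance [LocallyCompactSpace X] [T2Space X] : C0BanachAlgebra X (Gelfand X A) where
  smul_add' χ ξ η := Gelfand.ext' fun x => smul_add (χ x) (ξ.1 x) (η.1 x)
  add_smul' χ ψ ξ := Gelfand.ext' fun x => add_smul (χ x) (ψ x) (ξ.1 x)
  mul_smul' χ ψ ξ := Gelfand.ext' fun x => mul_smul (χ x) (ψ x) (ξ.1 x)
  smul_smul_left' z χ ξ := Gelfand.ext' fun x => mul_smul z (χ x) (ξ.1 x)
  smul_smul_right' z χ ξ := Gelfand.ext' fun x => smul_comm (χ x) z (ξ.1 x)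
  norm_smul_le' χ ξ := by
    refine Gelfand.norm_le (by positivity) fun x => ?_
    change ‖χ x • ξ.1 x‖ ≤ _
    rw [norm_smul]
    exact mul_le_mul (χ.toBCF.norm_coe_le_norm x) (norm_section_le ξ.1 x) (norm_nonneg _)
      (norm_nonneg _)
  smul_mul' χ ξ η := Gelfand.ext' fun x => (smul_mul_assoc (χ x) (ξ.1 x) (η.1 x)).symm
  mul_smul_comm' χ ξ η := Gelfand.ext' fun x => (mul_smul_comm (χ x) (ξ.1 x) (η.1 x)).symm
  nondegenerate' := by
    refine Metric.dense_iff.2 fun ξ ε hε => ?_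
    obtain ⟨K, hK, hK'⟩ := Filter.mem_cocompact.1
      (ξ.2.2.eventually (gt_mem_nhds (half_pos hε)))
    obtain ⟨f, hf1, -, hfc, hf⟩ := exists_continuous_one_zero_of_isCompact hK
      isClosed_empty (Set.disjoint_empty K)
    let χ : C₀(X, ℂ) :=
      { toFun := fun x => (f x : ℂ)
        continuous_toFun := by fun_prop
        zero_at_infty' := by
          have h0 : HasCompactSupport fun x => (f x : ℂ) := hfc.comp_left Complex.ofReal_zero
          exact h0.is_zero_at_infty }
    refine ⟨χ • ξ, ?_, Submodule.subset_span ⟨χ, ξ, rfl⟩⟩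
    rw [Metric.mem_ball, dist_eq_norm]
    refine lt_of_le_of_lt (Gelfand.norm_le (half_pos hε).le fun x => ?_) (half_lt_self hε)
    change ‖χ x • ξ.1 x - ξ.1 x‖ ≤ ε / 2
    have e : χ x • ξ.1 x - ξ.1 x = ((f x - 1 : ℝ) : ℂ) • ξ.1 x := by
      rw [Complex.ofReal_sub, Complex.ofReal_one, sub_smul, one_smul]
      rfl
    rw [e, norm_smul, Complex.norm_real]
    by_cases hx : x ∈ K
    · rw [hf1 hx]
      simp only [Pi.one_apply, sub_self, norm_zero, zero_mul]
      positivity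
    · have h1 : ‖ξ.1 x‖ < ε / 2 := hK' hx
      have h2 : ‖f x - 1‖ ≤ 1 := by
        rw [Real.norm_eq_abs, abs_le]
        exact ⟨by linarith [(hf x).1], by linarith [(hf x).2]⟩
      calc ‖f x - 1‖ * ‖ξ.1 x‖ ≤ 1 * (ε / 2) := by gcongr
        _ = ε / 2 := one_mul _

end Gelfand

section Hom

/-- A contractive `C₀(X)`-linear homomorphism of `C₀(X)`-Banach algebras. -/
structure ContractiveHom (X A B : Type*) [TopologicalSpace X]
    [NonUnitalNormedRing A] [NormedSpace ℂ A] [C0BanachAlgebra X A]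
    [NonUnitalNormedRing B] [NormedSpace ℂ B] [C0BanachAlgebra X B] extends A →ₙₐ[ℂ] B where
  map_C0_smul' (χ : C₀(X, ℂ)) (a : A) : toFun (χ • a) = χ • toFun a
  norm_map_le' (a : A) : ‖toFun a‖ ≤ ‖a‖

variable {X A B : Type*} [TopologicalSpace X]
  [NonUnitalNormedRing A] [NormedSpace ℂ A] [IsScalarTower ℂ A A] [SMulCommClass ℂ A A]
  [C0BanachAlgebra X A]
  [NonUnitalNormedRing B] [NormedSpace ℂ B] [IsScalarTower ℂ B B] [SMulCommClass ℂ B B]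
  [C0BanachAlgebra X B]

theorem ContractiveHom.continuous (φ : ContractiveHom X A B) :
    Continuous φ.toNonUnitalAlgHom :=
  AddMonoidHomClass.continuous_of_bound φ.toNonUnitalAlgHom 1 fun a => by
    rw [one_mul]
    exact φ.norm_map_le' a

theorem ContractiveHom.map_fibreIdeal (φ : ContractiveHom X A B) (x : X) :
    fibreIdeal X A x ≤ (fibreIdeal X B x).comap (φ.toNonUnitalAlgHom : A →ₗ[ℂ] B) := by
  refine closure_span_le_comap _ (fibreIdeal X B x) inferInstance
    (φ.toNonUnitalAlgHom : A →ₗ[ℂ] B) φ.continuous ?_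
  rintro _ ⟨χ, a, h, rfl⟩
  have : (φ.toNonUnitalAlgHom : A →ₗ[ℂ] B) (χ • a) = χ • φ.toNonUnitalAlgHom a :=
    φ.map_C0_smul' χ a
  rw [this]
  exact smul_mem_fibreIdeal X B h _

/-- The fibre map `φ_x : A_x → B_x`, `a_x ↦ φ(a)_x`. -/
def ContractiveHom.fibreMap (φ : ContractiveHom X A B) (x : X) :
    Fibre X A x →ₙₐ[ℂ] Fibre X B x where
  toFun := Submodule.mapQ _ _ (φ.toNonUnitalAlgHom : A →ₗ[ℂ] B) (φ.map_fibreIdeal x)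
  map_smul' z p := map_smul (Submodule.mapQ _ _ _ (φ.map_fibreIdeal x)) z p
  map_zero' := map_zero (Submodule.mapQ _ _ _ (φ.map_fibreIdeal x))
  map_add' p q := map_add (Submodule.mapQ _ _ _ (φ.map_fibreIdeal x)) p q
  map_mul' p q := by
    obtain ⟨a, rfl⟩ := fibreMk_surjective X A x p
    obtain ⟨b, rfl⟩ := fibreMk_surjective X A x q
    exact congrArg (fibreMk X B x) (map_mul φ.toNonUnitalAlgHom a b)

theorem ContractiveHom.fibreMap_mk (φ : ContractiveHom X A B) (x : X) (a : A) :
    φ.fibreMap x (fibreMk X A x a) = fibreMk X B x (φ.toNonUnitalAlgHom a) := rfl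

variable (X) in
theorem section_mem (a : A) : IsContSection X A (fun x => fibreMk X A x a) ∧
    VanishesAtInfty X A (fun x => fibreMk X A x a) := by
  refine ⟨fun x ε hε => ⟨a, .of_forall fun v => by simpa using hε.le⟩, ?_⟩
  refine Metric.tendsto_nhds.2 fun ε hε => ?_
  obtain ⟨b, hb, hbs⟩ := Metric.dense_iff.1 (nondegenerate' (X := X) (A := A)) a (ε / 2)
    (half_pos hε)
  have key : VanishesAtInfty X A (fun x => fibreMk X A x b) := by
    refine Submodule.span_induction (p := fun b _ =>
      VanishesAtInfty X A (fun x => fibreMk X A x b)) ?_ ?_ ?_ ?_ hbs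
    · rintro _ ⟨χ, c, rfl⟩
      have h0 : Filter.Tendsto (fun x => ‖χ x‖ * ‖c‖) (Filter.cocompact X) (𝓝 0) := by
        simpa using ((zero_at_infty χ).norm).mul_const ‖c‖
      refine squeeze_zero (fun _ => norm_nonneg _) (fun x => ?_) h0
      beta_reduce
      rw [fibreMk_smul, norm_smul]
      gcongr
      exact norm_fibreMk_le X A x c
    · simpa [VanishesAtInfty] using tendsto_const_nhds
    · intro c d _ _ hc hd
      refine squeeze_zero (fun _ => norm_nonneg _) (fun x => ?_) (by simpa using hc.add hd)
      beta_reduce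
      rw [map_add]
      exact norm_add_le _ _
    · intro z c _ hc
      have := hc.const_mul ‖z‖
      rw [mul_zero] at this
      refine this.congr fun x => ?_
      beta_reduce
      rw [map_smul, norm_smul]
  filter_upwards [Metric.tendsto_nhds.1 key (ε / 2) (half_pos hε)] with x hx
  rw [dist_zero_right, norm_norm] at hx ⊢
  rw [Metric.mem_ball, dist_comm, dist_eq_norm] at hb
  calc ‖fibreMk X A x a‖ = ‖fibreMk X A x (a - b) + fibreMk X A x b‖ := by
        rw [map_sub, sub_add_cancel]
    _ ≤ ‖a - b‖ + ‖fibreMk X A x b‖ :=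
        (norm_add_le _ _).trans (by gcongr; exact norm_fibreMk_le X A x _)
    _ < ε := by linarith

variable (X A) in
/-- The canonical homomorphism `ι_A : A → Â`, `a ↦ (x ↦ a_x)`. -/
noncomputable def gelfandHom [LocallyCompactSpace X] [T2Space X] :
    ContractiveHom X A (Gelfand X A) where
  toFun a := ⟨⟨fun x => fibreMk X A x a, bounded_of_section X A (section_mem X a).1
    (section_mem X a).2⟩, section_mem X a⟩
  map_smul' z a := Gelfand.ext' fun x => map_smul (fibreMk X A x) z a
  map_zero' := Gelfand.ext' fun x => map_zero (fibreMk X A x)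
  map_add' a b := Gelfand.ext' fun x => map_add (fibreMk X A x) a b
  map_mul' a b := Gelfand.ext' fun x => fibreMk_mul X A x a b
  map_C0_smul' χ a := Gelfand.ext' fun x => fibreMk_smul X A x χ a
  norm_map_le' a := Gelfand.norm_le (norm_nonneg a) fun x => norm_fibreMk_le X A x a

end Hom

end C0BanachAlgebra

/-! ### Isoradial and full homomorphisms -/

section Radius

variable {A B : Type*} [NonUnitalNormedRing A] [NormedSpace ℂ A] [IsScalarTower ℂ A A]
  [SMulCommClass ℂ A A] [NonUnitalNormedRing B] [NormedSpace ℂ B] [IsScalarTower ℂ B B]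
  [SMulCommClass ℂ B B]

/-- The spectral radius of an element of a (possibly non-unital) Banach algebra, i.e. its spectral
radius in the unitalisation. -/
noncomputable def banachSpectralRadius (a : A) : ℝ≥0∞ :=
  spectralRadius ℂ (a : Unitization ℂ A)

/-- A contractive homomorphism of Banach algebras is isoradial if it preserves spectral radii. -/
structure IsIsoradial (φ : A →ₙₐ[ℂ] B) : Prop where
  norm_map_le (a : A) : ‖φ a‖ ≤ ‖a‖
  radius_map (a : A) : banachSpectralRadius (φ a) = banachSpectralRadius a

/-- A full homomorphism: isoradial with dense range. -/
structure IsFull (φ : A →ₙₐ[ℂ] B) : Prop extends IsIsoradial φ where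
  denseRange : DenseRange φ

end Radius

/-! ### K-theory of complex Banach algebras -/

namespace BanachK

section KZero

/-- Equivalence of idempotent matrices (of possibly different sizes): `e = x y` and `f = y x`.
For idempotents this says that the projective modules they define are isomorphic. -/
def IdemEquiv {R : Type*} [Ring R] {ι κ : Type*} [Fintype ι] [Fintype κ]
    (e : Matrix ι ι R) (f : Matrix κ κ R) : Prop :=
  ∃ (x : Matrix ι κ R) (y : Matrix κ ι R), x * y = e ∧ y * x = f

/-- An idempotent square matrix of some finite size over `R`. -/
structure IdemMatrix (R : Type*) [Ring R] where
  size : ℕ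
  mat : Matrix (Fin size) (Fin size) R
  idem : mat * mat = mat

variable {R S T : Type*} [Ring R] [Ring S] [Ring T]

theorem IdemEquiv.refl {ι : Type*} [Fintype ι] {e : Matrix ι ι R} (he : e * e = e) :
    IdemEquiv e e := ⟨e, e, he, he⟩

theorem IdemEquiv.symm {ι κ : Type*} [Fintype ι] [Fintype κ] {e : Matrix ι ι R}
    {f : Matrix κ κ R} (h : IdemEquiv e f) : IdemEquiv f e := by
  obtain ⟨x, y, h₁, h₂⟩ := h
  exact ⟨y, x, h₂, h₁⟩

theorem IdemEquiv.trans {ι κ τ : Type*} [Fintype ι] [Fintype κ] [Fintype τ] {e : Matrix ι ι R}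
    {f : Matrix κ κ R} {g : Matrix τ τ R} (he : e * e = e) (hg : g * g = g)
    (h : IdemEquiv e f) (h' : IdemEquiv f g) : IdemEquiv e g := by
  obtain ⟨x, y, h₁, h₂⟩ := h
  obtain ⟨z, w, h₃, h₄⟩ := h'
  refine ⟨x * z, w * y, ?_, ?_⟩
  · calc x * z * (w * y) = x * (z * w) * y := by simp only [Matrix.mul_assoc]
      _ = (x * y) * (x * y) := by rw [h₃, ← h₂]; simp only [Matrix.mul_assoc]
      _ = e := by rw [h₁, he]
  · calc w * y * (x * z) = w * (y * x) * z := by simp only [Matrix.mul_assoc]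
      _ = (w * z) * (w * z) := by rw [h₂, ← h₃]; simp only [Matrix.mul_assoc]
      _ = g := by rw [h₄, hg]

theorem IdemEquiv.submatrix {ι κ : Type*} [Fintype ι] [Fintype κ] {e : Matrix ι ι R}
    (he : e * e = e) (σ : κ ≃ ι) : IdemEquiv e (e.submatrix σ σ) := by
  refine ⟨e.submatrix id σ, e.submatrix σ id, ?_, ?_⟩
  · rw [Matrix.submatrix_mul_equiv, he, Matrix.submatrix_id_id]
  · have := Matrix.submatrix_mul_equiv e e σ (Equiv.refl ι) σ
    simp only [Equiv.coe_refl] at this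
    rw [this, he]

theorem IdemEquiv.fromBlocks {ι κ ι' κ' : Type*} [Fintype ι] [Fintype κ] [Fintype ι'] [Fintype κ']
    {e : Matrix ι ι R} {f : Matrix κ κ R} {e' : Matrix ι' ι' R} {f' : Matrix κ' κ' R}
    (h : IdemEquiv e e') (h' : IdemEquiv f f') :
    IdemEquiv (Matrix.fromBlocks e 0 0 f) (Matrix.fromBlocks e' 0 0 f') := by
  obtain ⟨x, y, h₁, h₂⟩ := h
  obtain ⟨z, w, h₃, h₄⟩ := h'
  refine ⟨Matrix.fromBlocks x 0 0 z, Matrix.fromBlocks y 0 0 w, ?_, ?_⟩ <;>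
    simp [Matrix.fromBlocks_multiply, *]

theorem idem_fromBlocks {ι κ : Type*} [Fintype ι] [Fintype κ] {e : Matrix ι ι R}
    {f : Matrix κ κ R} (he : e * e = e) (hf : f * f = f) :
    Matrix.fromBlocks e 0 0 f * Matrix.fromBlocks e 0 0 f = Matrix.fromBlocks e 0 0 f := by
  simp [Matrix.fromBlocks_multiply, he, hf]

theorem idem_submatrix {ι κ : Type*} [Fintype ι] [Fintype κ] {e : Matrix ι ι R}
    (he : e * e = e) (σ : κ ≃ ι) : e.submatrix σ σ * e.submatrix σ σ = e.submatrix σ σ := by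
  rw [Matrix.submatrix_mul_equiv, he]

instance IdemMatrix.setoid (R : Type*) [Ring R] : Setoid (IdemMatrix R) where
  r e f := IdemEquiv e.mat f.mat
  iseqv :=
    { refl := fun e => IdemEquiv.refl e.idem
      symm := IdemEquiv.symm
      trans := fun {e _ g} h h' => IdemEquiv.trans e.idem g.idem h h' }

/-- The block sum `e ⊕ f`. -/
def IdemMatrix.sum (e f : IdemMatrix R) : IdemMatrix R where
  size := e.size + f.size
  mat := (Matrix.fromBlocks e.mat 0 0 f.mat).submatrix finSumFinEquiv.symm finSumFinEquiv.symm
  idem := idem_submatrix (idem_fromBlocks e.idem f.idem) _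

theorem IdemMatrix.sum_equiv (e f : IdemMatrix R) :
    IdemEquiv (e.sum f).mat (Matrix.fromBlocks e.mat 0 0 f.mat) :=
  (IdemEquiv.submatrix (idem_fromBlocks e.idem f.idem) _).symm

/-- The monoid of equivalence classes of idempotent matrices over `R`. -/
def IdemClass (R : Type*) [Ring R] : Type _ := Quotient (IdemMatrix.setoid R)

instance : Add (IdemClass R) where
  add := Quotient.map₂ IdemMatrix.sum (by
    intro e e' h f f' h'
    exact IdemEquiv.trans (e.sum f).idem (e'.sum f').idem
      (IdemEquiv.trans (e.sum f).idem (idem_fromBlocks e'.idem f'.idem)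
        (e.sum_equiv f) (h.fromBlocks h')) (e'.sum_equiv f').symm)

instance : Zero (IdemClass R) where
  zero := Quotient.mk _ ⟨0, 0, by simp⟩

instance : AddCommMonoid (IdemClass R) where
  nsmul := nsmulRec
  add_assoc := by
    rintro ⟨e⟩ ⟨f⟩ ⟨g⟩
    refine Quotient.sound ?_
    change IdemEquiv ((e.sum f).sum g).mat (e.sum (f.sum g)).mat
    have i₁ := idem_fromBlocks (idem_fromBlocks e.idem f.idem) g.idem
    have i₂ := idem_fromBlocks e.idem (idem_fromBlocks f.idem g.idem)
    have h₁ : IdemEquiv ((e.sum f).sum g).mat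
        (Matrix.fromBlocks (Matrix.fromBlocks e.mat 0 0 f.mat) 0 0 g.mat) :=
      ((e.sum f).sum_equiv g).trans ((e.sum f).sum g).idem i₁
        ((e.sum_equiv f).fromBlocks (IdemEquiv.refl g.idem))
    have h₂ : IdemEquiv (e.sum (f.sum g)).mat
        (Matrix.fromBlocks e.mat 0 0 (Matrix.fromBlocks f.mat 0 0 g.mat)) :=
      (e.sum_equiv (f.sum g)).trans (e.sum (f.sum g)).idem i₂
        ((IdemEquiv.refl e.idem).fromBlocks (f.sum_equiv g))
    have h₃ := IdemEquiv.submatrix i₂ (Equiv.sumAssoc _ _ _)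
    have h₄ : (Matrix.fromBlocks e.mat 0 0 (Matrix.fromBlocks f.mat 0 0 g.mat)).submatrix
        (Equiv.sumAssoc _ _ _) (Equiv.sumAssoc _ _ _) =
        Matrix.fromBlocks (Matrix.fromBlocks e.mat 0 0 f.mat) 0 0 g.mat := by
      ext i j
      rcases i with (i | i) | i <;> rcases j with (j | j) | j <;> rfl
    rw [h₄] at h₃
    exact h₁.trans ((e.sum f).sum g).idem (e.sum (f.sum g)).idem
      (h₃.symm.trans i₁ (e.sum (f.sum g)).idem h₂.symm)
  add_comm := by
    rintro ⟨e⟩ ⟨f⟩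
    refine Quotient.sound ?_
    change IdemEquiv (e.sum f).mat (f.sum e).mat
    have h₃ := IdemEquiv.submatrix (idem_fromBlocks e.idem f.idem) (Equiv.sumComm _ _)
    have h₄ : (Matrix.fromBlocks e.mat 0 0 f.mat).submatrix
        (Equiv.sumComm _ _) (Equiv.sumComm _ _) = Matrix.fromBlocks f.mat 0 0 e.mat := by
      ext i j
      rcases i with i | i <;> rcases j with j | j <;> rfl
    rw [h₄] at h₃
    exact (e.sum_equiv f).trans (e.sum f).idem (f.sum e).idem
      (h₃.trans (idem_fromBlocks e.idem f.idem) (f.sum e).idem (f.sum_equiv e).symm)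
  zero_add := by
    rintro ⟨f⟩
    refine Quotient.sound ?_
    let z : IdemMatrix R := ⟨0, 0, by simp⟩
    change IdemEquiv (z.sum f).mat f.mat
    refine (z.sum_equiv f).trans (z.sum f).idem f.idem ?_
    have h₃ := IdemEquiv.submatrix f.idem (Equiv.emptySum (Fin 0) (Fin f.size))
    have h₄ : f.mat.submatrix (Equiv.emptySum (Fin 0) (Fin f.size))
        (Equiv.emptySum (Fin 0) (Fin f.size)) = Matrix.fromBlocks z.mat 0 0 f.mat := by
      ext i j
      rcases i with i | i
      · exact i.elim0
      rcases j with j | j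
      · exact j.elim0
      rfl
    rw [h₄] at h₃
    exact h₃.symm
  add_zero := by
    rintro ⟨f⟩
    refine Quotient.sound ?_
    let z : IdemMatrix R := ⟨0, 0, by simp⟩
    change IdemEquiv (f.sum z).mat f.mat
    refine (f.sum_equiv z).trans (f.sum z).idem f.idem ?_
    have h₃ := IdemEquiv.submatrix f.idem (Equiv.sumEmpty (Fin f.size) (Fin 0))
    have h₄ : f.mat.submatrix (Equiv.sumEmpty (Fin f.size) (Fin 0))
        (Equiv.sumEmpty (Fin f.size) (Fin 0)) = Matrix.fromBlocks f.mat 0 0 z.mat := by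
      ext i j
      rcases i with i | i
      · rcases j with j | j
        · rfl
        · exact j.elim0
      · exact i.elim0
    rw [h₄] at h₃
    exact h₃.symm

/-- Apply a ring homomorphism entrywise to an idempotent matrix. -/
def IdemMatrix.map (f : R →+* S) (e : IdemMatrix R) : IdemMatrix S where
  size := e.size
  mat := e.mat.map f
  idem := by rw [← Matrix.map_mul, e.idem]

/-- The map on classes of idempotents induced by a ring homomorphism. -/
def IdemClass.map (f : R →+* S) : IdemClass R →+ IdemClass S where
  toFun := Quotient.map (IdemMatrix.map f) (by
    rintro e e' ⟨x, y, h₁, h₂⟩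
    have h₃ : x.map f * y.map f = e.mat.map f := by rw [← Matrix.map_mul, h₁]
    have h₄ : y.map f * x.map f = e'.mat.map f := by rw [← Matrix.map_mul, h₂]
    exact ⟨x.map f, y.map f, h₃, h₄⟩)
  map_zero' := by
    refine congrArg (Quotient.mk _) ?_
    simp only [IdemMatrix.map, IdemMatrix.mk.injEq, heq_eq_eq, true_and]
    ext i
    exact i.elim0
  map_add' := by
    rintro ⟨e⟩ ⟨e'⟩
    refine congrArg (Quotient.mk _) ?_
    have h : ((Matrix.fromBlocks e.mat 0 0 e'.mat).submatrix finSumFinEquiv.symm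
        finSumFinEquiv.symm).map f = (Matrix.fromBlocks (e.mat.map f) 0 0
          (e'.mat.map f)).submatrix finSumFinEquiv.symm finSumFinEquiv.symm := by
      rw [← Matrix.submatrix_map, Matrix.fromBlocks_map]
      simp
    simp only [IdemMatrix.map, IdemMatrix.sum, IdemMatrix.mk.injEq, heq_eq_eq, true_and]
    exact h

/-- `K₀` of a unital ring: the Grothendieck group of the classes of idempotent matrices. -/
abbrev K0Unital (R : Type*) [Ring R] : Type _ := Algebra.GrothendieckAddGroup (IdemClass R)

/-- The homomorphism `K₀(R) → K₀(S)` induced by a unital ring homomorphism. -/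
noncomputable def K0Unital.map (f : R →+* S) : K0Unital R →+ K0Unital S :=
  Algebra.GrothendieckAddGroup.lift (Algebra.GrothendieckAddGroup.of.comp (IdemClass.map f))

theorem K0Unital.map_of (f : R →+* S) (x : IdemClass R) :
    K0Unital.map f (Algebra.GrothendieckAddGroup.of x) =
      Algebra.GrothendieckAddGroup.of (IdemClass.map f x) :=
  DFunLike.congr_fun (Algebra.GrothendieckAddGroup.lift.symm_apply_apply
    (Algebra.GrothendieckAddGroup.of.comp (IdemClass.map f))) x

theorem K0Unital.map_map (g : S →+* T) (f : R →+* S) (x : K0Unital R) :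
    K0Unital.map g (K0Unital.map f x) = K0Unital.map (g.comp f) x := by
  have : (K0Unital.map g).comp (K0Unital.map f) = K0Unital.map (g.comp f) := by
    apply Algebra.GrothendieckAddGroup.lift.symm.injective
    ext x
    have key : IdemClass.map g (IdemClass.map f x) = IdemClass.map (g.comp f) x := by
      rcases x with ⟨e⟩
      rfl
    simp only [Algebra.GrothendieckAddGroup.lift_symm_apply, AddMonoidHom.comp_apply,
      K0Unital.map_of, key]
  exact DFunLike.congr_fun this x

end KZero

section KOne

variable (R S T : Type*) [NormedRing R] [NormedRing S] [NormedRing T]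

/-- `GL_n(R)`. -/
abbrev GLn (n : ℕ) : Type _ := (Matrix (Fin n) (Fin n) R)ˣ

instance (n : ℕ) : (Subgroup.connectedComponentOfOne (GLn R n)).Normal where
  conj_mem u hu g := by
    have hc : Continuous fun v : GLn R n => g * v * g⁻¹ := by fun_prop
    have := hc.image_connectedComponent_subset 1 ⟨u, hu, rfl⟩
    rwa [mul_one, mul_inv_cancel] at this

/-- `π₀(GL_n(R)) = GL_n(R) / GL_n(R)₀`. -/
abbrev Pi0GL (n : ℕ) : Type _ := GLn R n ⧸ Subgroup.connectedComponentOfOne (GLn R n)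

variable {R S T}

/-- The upper left corner embedding `M ↦ M ⊕ 1`. -/
def stabMatrix {n m : ℕ} (M : Matrix (Fin n) (Fin n) R) : Matrix (Fin m) (Fin m) R :=
  Matrix.of fun i j =>
    if h : (i : ℕ) < n ∧ (j : ℕ) < n then M ⟨i, h.1⟩ ⟨j, h.2⟩ else if i = j then 1 else 0

variable (R) in
/-- The upper left corner embedding as a homomorphism of multiplicative monoids. -/
def stabHom {n m : ℕ} (h : n ≤ m) :
    Matrix (Fin n) (Fin n) R →* Matrix (Fin m) (Fin m) R where
  toFun := stabMatrix
  map_one' := by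
    ext i j
    simp only [stabMatrix, Matrix.of_apply, Matrix.one_apply, Fin.ext_iff]
    split_ifs <;> rfl
  map_mul' M N := by
    obtain ⟨k, rfl⟩ := Nat.exists_eq_add_of_le h
    have d : ∀ (x : Fin n) (y : Fin k), Fin.castAdd k x ≠ Fin.natAdd n y := by
      intro x y hxy
      have := congrArg Fin.val hxy
      simp only [Fin.val_castAdd, Fin.val_natAdd] at this
      omega
    have d' : ∀ (x : Fin n) (y : Fin k), Fin.natAdd n y ≠ Fin.castAdd k x :=
      fun x y => (d x y).symm
    ext i j
    rw [Matrix.mul_apply, Fin.sum_univ_add]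
    induction i using Fin.addCases <;> induction j using Fin.addCases <;>
      simp [stabMatrix, Matrix.mul_apply, d, d']

theorem continuous_stabHom {n m : ℕ} (h : n ≤ m) : Continuous (stabHom R h) := by
  refine continuous_matrix fun i j => ?_
  simp only [stabHom, stabMatrix, MonoidHom.coe_mk, OneHom.coe_mk, Matrix.of_apply]
  split_ifs <;> fun_prop

theorem map_component {G H : Type*} [Group G] [TopologicalSpace G] [IsTopologicalGroup G]
    [Group H] [TopologicalSpace H] [IsTopologicalGroup H] (f : G →* H) (hf : Continuous f) :
    Subgroup.connectedComponentOfOne G ≤ (Subgroup.connectedComponentOfOne H).comap f := by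
  intro u hu
  have := hf.image_connectedComponent_subset 1 ⟨u, hu, rfl⟩
  rwa [map_one] at this

variable (R) in
/-- The stabilisation `π₀(GL_n(R)) → π₀(GL_m(R))`. -/
def stabPi0 (n m : ℕ) (h : n ≤ m) : Pi0GL R n →* Pi0GL R m :=
  QuotientGroup.map _ _ (Units.map (stabHom R h))
    (map_component _ ((continuous_stabHom h).units_map _))

instance : DirectedSystem (Pi0GL R) (stabPi0 R · · ·) where
  map_self n x := by
    induction x using QuotientGroup.induction_on with | _ u => ?_
    refine congrArg _ (Units.ext ?_)
    ext i j
    simp [stabHom, stabMatrix]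
  map_map n m k h h' x := by
    induction x using QuotientGroup.induction_on with | _ u => ?_
    refine congrArg _ (Units.ext ?_)
    ext i j
    simp only [stabHom, stabMatrix, Units.coe_map, MonoidHom.coe_mk, OneHom.coe_mk,
      Matrix.of_apply, Fin.ext_iff]
    grind

variable (R) in
/-- Topological `K₁` of a unital Banach algebra: the direct limit of the groups
`π₀(GL_n(R))` along `u ↦ u ⊕ 1`. -/
abbrev K1Unital : Type _ := DirectLimit (Pi0GL R) (stabPi0 R)

/-- The map `π₀(GL_n(R)) → π₀(GL_n(S))` induced by a continuous unital ring homomorphism. -/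
def Pi0GL.map (f : R →+* S) (hf : Continuous f) (n : ℕ) : Pi0GL R n →* Pi0GL S n :=
  QuotientGroup.map _ _ (Units.map (f.mapMatrix : Matrix (Fin n) (Fin n) R →+* _).toMonoidHom)
    (map_component _ (Continuous.units_map (f.mapMatrix : Matrix (Fin n) (Fin n) R →+* _).toMonoidHom
      (continuous_id.matrix_map hf)))

/-- The homomorphism `K₁(R) → K₁(S)` induced by a continuous unital ring homomorphism. -/
noncomputable def K1Unital.map (f : R →+* S) (hf : Continuous f) : K1Unital R →* K1Unital S where
  toFun := DirectLimit.map _ _ (fun n => Pi0GL.map f hf n) (by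
    intro n m h x
    induction x using QuotientGroup.induction_on with | _ u => ?_
    refine congrArg _ (Units.ext ?_)
    ext i j
    simp [stabHom, stabMatrix]
    split_ifs <;> simp)
  map_one' := by
    rw [DirectLimit.one_def 0, DirectLimit.map_def, map_one, ← DirectLimit.one_def]
  map_mul' x y := by
    induction x, y using DirectLimit.induction₂ with | _ n x y => ?_
    simp only [DirectLimit.mul_def, DirectLimit.map_def, map_mul]

theorem K1Unital.map_map (g : S →+* T) (hg : Continuous g) (f : R →+* S) (hf : Continuous f)
    (x : K1Unital R) :
    K1Unital.map g hg (K1Unital.map f hf x) = K1Unital.map (g.comp f) (hg.comp hf) x := by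
  induction x using DirectLimit.induction with | _ n x => ?_
  induction x using QuotientGroup.induction_on with | _ u => rfl

end KOne

section NonUnital

variable (A : Type*) [NonUnitalNormedRing A] [NormedSpace ℂ A] [IsScalarTower ℂ A A]
  [SMulCommClass ℂ A A]
variable {B : Type*} [NonUnitalNormedRing B] [NormedSpace ℂ B] [IsScalarTower ℂ B B]
  [SMulCommClass ℂ B B]

/-- The unitalisation `A⁺ = ℂ ⊕ A` with the norm `|z| + ‖a‖`. -/
abbrev Plus : Type _ := WithLp 1 (Unitization ℂ A)

/-- The augmentation `A⁺ → ℂ`, `z + a ↦ z`. -/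
noncomputable def augmentation : Plus A →+* ℂ :=
  (((Unitization.fstHom ℂ A).comp
    (WithLp.unitizationAlgEquiv (𝕜 := ℂ) (A := A) ℂ).toAlgHom : Plus A →ₐ[ℂ] ℂ) : Plus A →+* ℂ)

theorem continuous_augmentation : Continuous (augmentation A) := by
  refine AddMonoidHomClass.continuous_of_bound (augmentation A) 1 fun x => ?_
  rw [one_mul, WithLp.unitization_norm_def]
  exact le_add_of_nonneg_right (norm_nonneg _)

variable {A}

/-- The unital extension `φ⁺ : A⁺ → B⁺`, `z + a ↦ z + φ(a)`. -/
noncomputable def plusMap (φ : A →ₙₐ[ℂ] B) : Plus A →+* Plus B :=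
  (((WithLp.unitizationAlgEquiv (𝕜 := ℂ) (A := B) ℂ).symm.toAlgHom.comp
    ((Unitization.lift ((Unitization.inrNonUnitalAlgHom ℂ B).comp φ)).comp
      (WithLp.unitizationAlgEquiv (𝕜 := ℂ) (A := A) ℂ).toAlgHom) :
        Plus A →ₐ[ℂ] Plus B) : Plus A →+* Plus B)

theorem plusMap_apply (φ : A →ₙₐ[ℂ] B) (x : Plus A) :
    plusMap φ x = WithLp.toLp 1
      (Unitization.inl (WithLp.ofLp x).fst + Unitization.inr (φ (WithLp.ofLp x).snd)) := rfl

theorem augmentation_comp_plusMap (φ : A →ₙₐ[ℂ] B) :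
    (augmentation B).comp (plusMap φ) = augmentation A := by
  ext x
  change (Unitization.inl (WithLp.ofLp x).fst +
    Unitization.inr (φ (WithLp.ofLp x).snd) : Unitization ℂ B).fst = (WithLp.ofLp x).fst
  simp

theorem continuous_plusMap (φ : A →ₙₐ[ℂ] B) (hφ : Continuous φ) : Continuous (plusMap φ) := by
  have hA := (WithLp.uniformEquiv_unitization_addEquiv_prod ℂ A).continuous
  have hB := (WithLp.uniformEquiv_unitization_addEquiv_prod ℂ B).symm.continuous
  have h1 : Continuous fun x : Plus A => (WithLp.ofLp x).fst :=
    continuous_fst.comp ((WithLp.prod_continuous_ofLp 1 ℂ A).comp hA)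
  have h2 : Continuous fun x : Plus A => (WithLp.ofLp x).snd :=
    continuous_snd.comp ((WithLp.prod_continuous_ofLp 1 ℂ A).comp hA)
  have h3 := hB.comp ((WithLp.prod_continuous_toLp 1 ℂ B).comp (h1.prodMk (hφ.comp h2)))
  refine h3.congr fun x => ?_
  rw [plusMap_apply]
  refine congrArg (WithLp.toLp 1) (Unitization.ext ?_ ?_)
  · rw [Unitization.fst_add, Unitization.fst_inl, Unitization.fst_inr, add_zero]
    rfl
  · rw [Unitization.snd_add, Unitization.snd_inl, Unitization.snd_inr, zero_add]
    rfl

variable (A) in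
/-- `K₀(A) = ker (K₀(A⁺) → K₀(ℂ))`. -/
noncomputable def K0 : AddSubgroup (K0Unital (Plus A)) := (K0Unital.map (augmentation A)).ker

variable (A) in
/-- `K₁(A) = ker (K₁(A⁺) → K₁(ℂ))`. -/
noncomputable def K1 : Subgroup (K1Unital (Plus A)) :=
  (K1Unital.map (augmentation A) (continuous_augmentation A)).ker

/-- `φ_* : K₀(A) → K₀(B)`. -/
noncomputable def K0.map (φ : A →ₙₐ[ℂ] B) : K0 A →+ K0 B :=
  ((K0Unital.map (plusMap φ)).comp (K0 A).subtype).codRestrict (K0 B) fun x => by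
    change K0Unital.map (augmentation B) (K0Unital.map (plusMap φ) x) = 0
    rw [K0Unital.map_map, augmentation_comp_plusMap]
    exact x.2

/-- `φ_* : K₁(A) → K₁(B)`. -/
noncomputable def K1.map (φ : A →ₙₐ[ℂ] B) (hφ : Continuous φ) : K1 A →* K1 B :=
  ((K1Unital.map (plusMap φ) (continuous_plusMap φ hφ)).comp (K1 A).subtype).codRestrict (K1 B)
    fun x => by
      change K1Unital.map (augmentation B) (continuous_augmentation B)
        (K1Unital.map (plusMap φ) (continuous_plusMap φ hφ) x) = 1
      rw [K1Unital.map_map]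
      simp only [augmentation_comp_plusMap]
      exact x.2

end NonUnital

end BanachK

/-!
Inverses in a `C₀(X)`-Banach algebra `A` can be glued with cut-off functions: if the image of `a`
in the fibre at `x` is quasi-invertible, then `a` has a quasi-inverse near `x`, and near infinity
`a` is small. Hence quasi-invertibility, and with it the spectral radius, is detected by the fibres,
so a fibrewise isoradial homomorphism is isoradial. The same cut-off functions give a
Stone–Weierstrass theorem: a `C₀(X)`-invariant subgroup of the Gelfand transform that is dense in
every fibre is dense. Therefore `ι_A` is full and, if `φ` is fibrewise full, so is `ι_{A'} ∘ φ`;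
`φ` itself need not have dense range.

A full homomorphism has dense range and reflects invertibility on unitalisations, and both
properties pass to matrix algebras by Schur complements. It then induces an isomorphism on `K₀`,
because an idempotent of the target is equivalent to the image of
`(1 + (2 a - 1) (1 - 4 (a - a²)) ^ (-1 / 2)) / 2` for a suitable approximate idempotent `a` of the
source, and on `K₁`, because it induces bijections on the components of the general linear groups.
So `ι_{A'}` and `ι_{A'} ∘ φ` are isomorphisms in K-theory, and hence so is `φ`.
-/

section Quasiregular

theorem left_quasiInverse_eq_right_quasiInverse {R : Type*} [NonUnitalSemiring R] {a b c : R}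
    (hb : b + a + b * a = 0) (hc : a + c + a * c = 0) : b = c := by
  have hba : PreQuasiregular.equiv b * PreQuasiregular.equiv a = 1 :=
    PreQuasiregular.equiv.symm.injective ((add_comm b a ▸ hb :) : a + b + b * a = 0)
  have hac : PreQuasiregular.equiv a * PreQuasiregular.equiv c = 1 :=
    PreQuasiregular.equiv.symm.injective ((add_comm a c ▸ hc :) : c + a + a * c = 0)
  exact PreQuasiregular.equiv.injective (left_inv_eq_right_inv hba hac)

variable {A B : Type*} [NonUnitalNormedRing A] [NormedSpace ℂ A] [IsScalarTower ℂ A A]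
  [SMulCommClass ℂ A A] [NonUnitalNormedRing B] [NormedSpace ℂ B] [IsScalarTower ℂ B B]
  [SMulCommClass ℂ B B]

theorem isQuasiregular_of_norm_lt_one [CompleteSpace A] {a : A} (ha : ‖a‖ < 1) :
    IsQuasiregular a := by
  rw [isQuasiregular_iff_isUnit' ℂ]
  have h : IsUnit (1 - WithLp.toLp 1 (-(a : Unitization ℂ A)) : BanachK.Plus A) := by
    refine isUnit_one_sub_of_norm_lt_one ?_
    rw [WithLp.unitization_norm_def]
    simpa using ha
  have := h.map (WithLp.unitizationAlgEquiv (𝕜 := ℂ) (A := A) ℂ)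
  rw [map_sub, map_one] at this
  simpa using this

theorem banachSpectralRadius_le_iff {a : A} {r : ℝ≥0∞} :
    banachSpectralRadius a ≤ r ↔
      ∀ z : ℂˣ, ¬ IsQuasiregular (-(z⁻¹ • a)) → (‖(z : ℂ)‖₊ : ℝ≥0∞) ≤ r := by
  rw [banachSpectralRadius, spectralRadius, ← Unitization.quasispectrum_eq_spectrum_inr ℂ a,
    iSup₂_le_iff]
  refine ⟨fun h z hz => h z (quasispectrum.mem_of_not_quasiregular a hz), fun h z hz => ?_⟩
  by_cases hz0 : IsUnit z
  · exact h hz0.unit (hz hz0)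
  · rw [isUnit_iff_ne_zero, not_not] at hz0
    simp [hz0]

theorem isQuasiregular_of_banachSpectralRadius_lt {a : A} {z : ℂˣ}
    (h : banachSpectralRadius a < ‖(z : ℂ)‖₊) : IsQuasiregular (-(z⁻¹ • a)) := by
  by_contra hz
  exact (banachSpectralRadius_le_iff.1 le_rfl z hz).not_gt h

theorem banachSpectralRadius_le_norm [CompleteSpace A] (a : A) :
    banachSpectralRadius a ≤ ‖a‖₊ := by
  refine banachSpectralRadius_le_iff.2 fun z hz => ?_
  contrapose! hz
  have hza : ‖a‖ < ‖(z : ℂ)‖ := by exact_mod_cast hz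
  refine isQuasiregular_of_norm_lt_one ?_
  rwa [norm_neg, Units.smul_def, norm_smul, Units.val_inv_eq_inv_val, norm_inv,
    inv_mul_lt_iff₀ (norm_pos_iff.2 z.ne_zero), mul_one]

theorem isIsoradial_of_isQuasiregular_imp (φ : A →ₙₐ[ℂ] B) (hφ : ∀ a, ‖φ a‖ ≤ ‖a‖)
    (h : ∀ a, IsQuasiregular (φ a) → IsQuasiregular a) : IsIsoradial φ where
  norm_map_le := hφ
  radius_map a := by
    refine eq_of_forall_ge_iff fun r => ?_
    simp only [banachSpectralRadius_le_iff, Units.smul_def, ← map_smul, ← map_neg]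
    exact forall_congr' fun z => imp_congr_left (not_congr ⟨h _, fun ha => ha.map φ⟩)

end Quasiregular

theorem tendsto_of_mem_closure_span {𝕜 ι E F : Type*} [NormedField 𝕜] [SeminormedAddCommGroup E]
    [NormedSpace 𝕜 E] [SeminormedAddCommGroup F] [NormedSpace 𝕜 F] {l : Filter ι}
    {f : ι → E →L[𝕜] F} (hf : Equicontinuous fun i => ⇑(f i)) (g : E →L[𝕜] F) {s : Set E}
    (hs : ∀ b ∈ s, Filter.Tendsto (fun i => f i b) l (𝓝 (g b))) {b : E}
    (hb : b ∈ (Submodule.span 𝕜 s).topologicalClosure) :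
    Filter.Tendsto (fun i => f i b) l (𝓝 (g b)) := by
  let S : Submodule 𝕜 E :=
    { carrier := {b | Filter.Tendsto (fun i => f i b) l (𝓝 (g b))}
      zero_mem' := by simpa using tendsto_const_nhds
      add_mem' := fun ha hb => by simpa using Filter.Tendsto.add ha hb
      smul_mem' := fun z a ha => by simpa using Filter.Tendsto.const_smul ha z }
  have hS : IsClosed (S : Set E) := hf.isClosed_setOfPred_tendsto g.continuous
  exact Submodule.topologicalClosure_minimal (t := S) _ (Submodule.span_le.2 hs) hS hb

namespace C0BanachAlgebra

section Cutoff

variable {X : Type*} [TopologicalSpace X]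

/-- Cut-off functions: elements of `C₀(X)` with values in the real interval `[0, 1]`. -/
def IsCutoff (χ : C₀(X, ℂ)) : Prop := ∀ v, ∃ t ∈ Set.Icc (0 : ℝ) 1, χ v = t

theorem norm_le_of_forall {χ : C₀(X, ℂ)} {C : ℝ} (hC : 0 ≤ C) (h : ∀ v, ‖χ v‖ ≤ C) : ‖χ‖ ≤ C :=
  (BoundedContinuousFunction.norm_le (f := χ.toBCF) hC).2 h

theorem IsCutoff.norm_apply_add_norm_one_sub_apply {χ : C₀(X, ℂ)} (h : IsCutoff χ) (v : X) :
    ‖χ v‖ + ‖1 - χ v‖ = 1 := by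
  obtain ⟨t, ht, e⟩ := h v
  rw [e, ← Complex.ofReal_one, ← Complex.ofReal_sub, Complex.norm_real, Complex.norm_real,
    Real.norm_of_nonneg ht.1, Real.norm_of_nonneg (sub_nonneg.2 ht.2), add_sub_cancel]

theorem IsCutoff.norm_apply_le {χ : C₀(X, ℂ)} (h : IsCutoff χ) (v : X) : ‖χ v‖ ≤ 1 := by
  linarith [h.norm_apply_add_norm_one_sub_apply v, norm_nonneg (1 - χ v)]

theorem IsCutoff.norm_le {χ : C₀(X, ℂ)} (h : IsCutoff χ) : ‖χ‖ ≤ 1 :=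
  norm_le_of_forall zero_le_one h.norm_apply_le

theorem IsCutoff.zero : IsCutoff (0 : C₀(X, ℂ)) := fun _ => ⟨0, by simp, by simp⟩

-- `1 - (1 - χ) * (1 - ψ)`, spelled out because `C₀(X)` has no unit.
theorem IsCutoff.union {χ ψ : C₀(X, ℂ)} (h : IsCutoff χ) (h' : IsCutoff ψ) :
    IsCutoff (χ + (ψ - χ * ψ)) := by
  intro v
  obtain ⟨t, ht, e⟩ := h v
  obtain ⟨s, hs, e'⟩ := h' v
  refine ⟨t + (s - t * s), ⟨?_, ?_⟩, by simp [e, e']⟩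
  · nlinarith [ht.1, mul_nonneg (sub_nonneg.2 ht.2) hs.1]
  · nlinarith [mul_nonneg (sub_nonneg.2 ht.2) (sub_nonneg.2 hs.2)]

theorem IsCutoff.norm_union_apply {χ ψ : C₀(X, ℂ)} (h : IsCutoff χ) (h' : IsCutoff ψ) (v : X) :
    ‖(χ + (ψ - χ * ψ)) v‖ = ‖χ v‖ + ‖1 - χ v‖ * ‖ψ v‖ := by
  have hχ := h.norm_apply_add_norm_one_sub_apply v
  have hψ := h'.norm_apply_add_norm_one_sub_apply v
  have hχψ := (h.union h').norm_apply_add_norm_one_sub_apply v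
  have e : 1 - (χ + (ψ - χ * ψ)) v = (1 - χ v) * (1 - ψ v) := by
    rw [ZeroAtInftyContinuousMap.add_apply, ZeroAtInftyContinuousMap.sub_apply,
      ZeroAtInftyContinuousMap.mul_apply]
    ring
  rw [e, norm_mul] at hχψ
  linear_combination hχψ - hχ - ‖1 - χ v‖ * hψ

theorem exists_eq_one_on_isCompact {P : C₀(X, ℂ) → Prop} {K : Set X} (hK : IsCompact K)
    (zero : P 0) (union : ∀ χ ψ, P χ → P ψ → P (χ + (ψ - χ * ψ)))
    (nhds : ∀ x ∈ K, ∃ χ, P χ ∧ ∀ᶠ v in 𝓝 x, χ v = 1) : ∃ χ, P χ ∧ ∀ v ∈ K, χ v = 1 := by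
  refine hK.induction_on (p := fun s => ∃ χ, P χ ∧ ∀ v ∈ s, χ v = 1) ⟨0, zero, by simp⟩ ?_ ?_ ?_
  · rintro s t hst ⟨χ, hχ, h1⟩
    exact ⟨χ, hχ, fun v hv => h1 v (hst hv)⟩
  · rintro s t ⟨χ, hχ, h1⟩ ⟨ψ, hψ, h1'⟩
    refine ⟨_, union χ ψ hχ hψ, ?_⟩
    rintro v (hv | hv)
    · simp [h1 v hv]
    · simp [h1' v hv]
  · intro x hx
    obtain ⟨χ, hχ, h1⟩ := nhds x hx
    exact ⟨_, mem_nhdsWithin_of_mem_nhds h1, χ, hχ, fun _ hv => hv⟩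

section Existence

variable [LocallyCompactSpace X] [RegularSpace X]

theorem exists_isCutoff {K U : Set X} (hK : IsCompact K) (hU : IsOpen U) (hKU : K ⊆ U) :
    ∃ χ : C₀(X, ℂ), IsCutoff χ ∧ (∀ v ∈ K, χ v = 1) ∧ ∀ v ∉ U, χ v = 0 := by
  obtain ⟨f, hf1, hf0, hfc, hf⟩ := exists_continuous_one_zero_of_isCompact hK
    hU.isClosed_compl (Set.disjoint_compl_right_iff_subset.2 hKU)
  have h0 : HasCompactSupport fun x => (f x : ℂ) := hfc.comp_left Complex.ofReal_zero
  refine ⟨⟨⟨fun x => (f x : ℂ), by fun_prop⟩, h0.is_zero_at_infty⟩, fun v => ⟨f v, hf v, rfl⟩,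
    fun v hv => ?_, fun v hv => ?_⟩
  · exact (congrArg Complex.ofReal (hf1 hv)).trans Complex.ofReal_one
  · exact (congrArg Complex.ofReal (hf0 hv)).trans Complex.ofReal_zero

theorem exists_isCutoff_nhds {x : X} {U : Set X} (hU : U ∈ 𝓝 x) :
    ∃ χ : C₀(X, ℂ), IsCutoff χ ∧ (∀ᶠ v in 𝓝 x, χ v = 1) ∧ ∀ v ∉ U, χ v = 0 := by
  obtain ⟨K, hK, hKU, hKc⟩ := local_compact_nhds (interior_mem_nhds.2 hU)
  obtain ⟨χ, hχ, h1, h0⟩ := exists_isCutoff hKc isOpen_interior hKU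
  exact ⟨χ, hχ, Filter.mem_of_superset hK h1, fun v hv => h0 v fun h => hv (interior_subset h)⟩

end Existence

variable (X) in
/-- The type of cut-off functions, used as an index set for limits. -/
abbrev Cutoff : Type _ := {χ : C₀(X, ℂ) // IsCutoff χ}

namespace Cutoff

/-- The filter of cut-off functions whose support shrinks to the point `x`. -/
def atPoint (x : X) : Filter (Cutoff X) := (𝓝 x).smallSets.comap fun χ => {v | χ.1 v ≠ 0}

variable (X) in
/-- The filter of cut-off functions that are `1` on larger and larger compact sets. -/
def atInfty : Filter (Cutoff X) := (Filter.cocompact X).smallSets.comap fun χ => {v | χ.1 v ≠ 1}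

theorem eventually_atPoint {x : X} {p : Cutoff X → Prop} :
    (∀ᶠ χ in atPoint x, p χ) ↔ ∃ U ∈ 𝓝 x, ∀ χ : Cutoff X, (∀ v ∉ U, χ.1 v = 0) → p χ := by
  simp only [atPoint, Filter.eventually_comap, Filter.eventually_smallSets]
  refine exists_congr fun U => and_congr_right fun _ => ?_
  refine ⟨fun h χ hχ => h _ (fun v hv => ?_) χ rfl, ?_⟩
  · by_contra hvU
    exact hv (hχ v hvU)
  · rintro h _ hU χ rfl
    exact h χ fun v hv => by_contra fun h0 => hv (hU h0)

theorem eventually_atInfty {p : Cutoff X → Prop} :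
    (∀ᶠ χ in atInfty X, p χ) ↔ ∃ K, IsCompact K ∧ ∀ χ : Cutoff X, (∀ v ∈ K, χ.1 v = 1) → p χ := by
  simp only [atInfty, Filter.eventually_comap, Filter.eventually_smallSets]
  constructor
  · rintro ⟨S, hS, h⟩
    obtain ⟨K, hK, hKS⟩ := Filter.mem_cocompact.1 hS
    refine ⟨K, hK, fun χ hχ => h {v | χ.1 v ≠ 1} (fun v hv => hKS fun hvK => hv (hχ v hvK)) χ rfl⟩
  · rintro ⟨K, hK, h⟩
    refine ⟨Kᶜ, hK.compl_mem_cocompact, ?_⟩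
    rintro _ hK' χ rfl
    exact h χ fun v hv => by_contra fun h1 => hK' h1 hv

theorem tendsto_mul_atPoint {x : X} {ψ : C₀(X, ℂ)} (hψ : ψ x = 0) :
    Filter.Tendsto (fun χ : Cutoff X => χ.1 * ψ) (atPoint x) (𝓝 0) := by
  refine Metric.nhds_basis_closedBall.tendsto_right_iff.2 fun ε hε => ?_
  have hU : ∀ᶠ v in 𝓝 x, ‖ψ v‖ < ε :=
    (map_continuous ψ).norm.continuousAt.eventually (gt_mem_nhds (by simpa [hψ] using hε))
  refine eventually_atPoint.2 ⟨_, hU, fun χ hχ => ?_⟩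
  rw [mem_closedBall_zero_iff]
  refine norm_le_of_forall hε.le fun v => ?_
  rw [ZeroAtInftyContinuousMap.mul_apply, norm_mul]
  by_cases hv : ‖ψ v‖ < ε
  · exact (mul_le_of_le_one_left (norm_nonneg _) (χ.2.norm_apply_le v)).trans hv.le
  · simpa [hχ v hv] using hε.le

theorem tendsto_mul_atInfty (ψ : C₀(X, ℂ)) :
    Filter.Tendsto (fun χ : Cutoff X => χ.1 * ψ) (atInfty X) (𝓝 ψ) := by
  refine Metric.nhds_basis_closedBall.tendsto_right_iff.2 fun ε hε => ?_
  obtain ⟨K, hK, hKψ⟩ := Filter.mem_cocompact.1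
    ((zero_at_infty ψ).norm.eventually (gt_mem_nhds (by rwa [norm_zero] : ‖(0 : ℂ)‖ < _)))
  refine eventually_atInfty.2 ⟨K, hK, fun χ hχ => ?_⟩
  rw [mem_closedBall_iff_norm]
  refine norm_le_of_forall hε.le fun v => ?_
  rw [ZeroAtInftyContinuousMap.sub_apply, ZeroAtInftyContinuousMap.mul_apply, ← sub_one_mul,
    norm_mul]
  by_cases hv : v ∈ K
  · simpa [hχ v hv] using hε.le
  · have hvψ : ‖ψ v‖ < ε := hKψ hv
    have h1 : ‖χ.1 v - 1‖ ≤ 1 := by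
      rw [norm_sub_rev]
      linarith [χ.2.norm_apply_add_norm_one_sub_apply v, norm_nonneg (χ.1 v)]
    exact (mul_le_of_le_one_left (norm_nonneg _) h1).trans hvψ.le

end Cutoff

end Cutoff

section Module

variable {X A : Type*} [TopologicalSpace X] [NonUnitalNormedRing A] [NormedSpace ℂ A]
  [C0BanachAlgebra X A]

variable (X A) in
/-- The action of `C₀(X)` on `A` as a continuous bilinear map. -/
noncomputable def smulL : C₀(X, ℂ) →L[ℂ] A →L[ℂ] A :=
  LinearMap.mkContinuous₂ (LinearMap.mk₂ ℂ (fun (χ : C₀(X, ℂ)) (a : A) => χ • a)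
    add_smul' smul_smul_left' smul_add' fun z χ a => smul_smul_right' z χ a) 1
    fun χ a => by simpa using norm_smul_le' χ a

theorem smulL_apply (χ : C₀(X, ℂ)) (a : A) : smulL X A χ a = χ • a := rfl

theorem sub_smul' (χ ψ : C₀(X, ℂ)) (a : A) : (χ - ψ) • a = χ • a - ψ • a := by
  simp only [← smulL_apply, map_sub, _root_.sub_apply]

theorem zero_smul' (a : A) : (0 : C₀(X, ℂ)) • a = 0 := by
  simp only [← smulL_apply, map_zero, _root_.zero_apply]

theorem IsCutoff.norm_smul_le {χ : C₀(X, ℂ)} (h : IsCutoff χ) (a : A) : ‖χ • a‖ ≤ ‖a‖ :=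
  (norm_smul_le' χ a).trans (mul_le_of_le_one_left (norm_nonneg a) h.norm_le)

variable (X A) in
theorem Cutoff.equicontinuous_smulL : Equicontinuous fun χ : Cutoff X => ⇑(smulL X A χ.1) := by
  refine (LipschitzWith.uniformEquicontinuous _ 1 fun χ => ?_).equicontinuous
  exact AddMonoidHomClass.lipschitz_of_bound_nnnorm (smulL X A χ.1) 1 fun a =>
    (χ.2.norm_smul_le a).trans_eq (one_mul _).symm

theorem Cutoff.tendsto_smul_atInfty (a : A) :
    Filter.Tendsto (fun χ : Cutoff X => χ.1 • a) (Cutoff.atInfty X) (𝓝 a) := by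
  refine tendsto_of_mem_closure_span (Cutoff.equicontinuous_smulL X A) (.id ℂ A) ?_
    (nondegenerate' (X := X) a)
  rintro _ ⟨ψ, b, rfl⟩
  have h := (((smulL X A).flip b).continuous.tendsto ψ).comp (Cutoff.tendsto_mul_atInfty ψ)
  exact h.congr fun χ => mul_smul' χ.1 ψ b

theorem Cutoff.tendsto_smul_atPoint {x : X} {k : A} (hk : k ∈ fibreIdeal X A x) :
    Filter.Tendsto (fun χ : Cutoff X => χ.1 • k) (Cutoff.atPoint x) (𝓝 0) := by
  refine tendsto_of_mem_closure_span (Cutoff.equicontinuous_smulL X A) 0 ?_ hk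
  rintro _ ⟨ψ, b, hψ, rfl⟩
  have h := (((smulL X A).flip b).continuous.tendsto 0).comp (Cutoff.tendsto_mul_atPoint hψ)
  rw [map_zero] at h
  exact h.congr fun χ => mul_smul' χ.1 ψ b

variable (X) in
theorem exists_isCompact_norm_sub_smul_lt (a : A) {ε : ℝ} (hε : 0 < ε) :
    ∃ K : Set X, IsCompact K ∧ ∀ χ : C₀(X, ℂ), IsCutoff χ → (∀ v ∈ K, χ v = 1) →
      ‖a - χ • a‖ < ε := by
  have hlim : ∀ᶠ χ in Cutoff.atInfty X, ‖a - χ.1 • a‖ < ε :=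
    ((Cutoff.tendsto_smul_atInfty a).const_sub a).norm.eventually (gt_mem_nhds (by simpa))
  obtain ⟨K, hK, h⟩ := Cutoff.eventually_atInfty.1 hlim
  exact ⟨K, hK, fun χ hχ => h ⟨χ, hχ⟩⟩

end Module

end C0BanachAlgebra

namespace C0BanachAlgebra

section FibreDetection

variable {X A : Type*} [TopologicalSpace X] [NonUnitalNormedRing A] [NormedSpace ℂ A]
  [C0BanachAlgebra X A]

/-- The functions `χ ∈ C₀(X)` with `χ A ⊆ A (1 + a)`: multiplication by `χ` factors through right
multiplication by `1 + a`, so `1 + a` has a left inverse wherever `χ = 1`. -/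
def InvertsLeft (a : A) (χ : C₀(X, ℂ)) : Prop := ∀ d : A, ∃ g : A, χ • d = g + g * a

theorem InvertsLeft.union {a : A} {χ ψ : C₀(X, ℂ)} (h : InvertsLeft a χ) (h' : InvertsLeft a ψ) :
    InvertsLeft a (χ + (ψ - χ * ψ)) := by
  intro d
  obtain ⟨g, hg⟩ := h d
  obtain ⟨k, hk⟩ := h' d
  refine ⟨g + (k - χ • k), ?_⟩
  rw [add_smul', sub_smul', mul_smul', hg, hk, smul_add', smul_mul']
  noncomm_ring

variable [LocallyCompactSpace X] [RegularSpace X]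

theorem exists_isCutoff_norm_smul_lt {x : X} {a : A} {ε : ℝ} (h : ‖fibreMk X A x a‖ < ε) :
    ∃ χ : C₀(X, ℂ), IsCutoff χ ∧ (∀ᶠ v in 𝓝 x, χ v = 1) ∧ ‖χ • a‖ < ε := by
  obtain ⟨b, hb, hbε⟩ : ∃ b, fibreMk X A x b = fibreMk X A x a ∧
      ‖b‖ < ‖fibreMk X A x a‖ + (ε - ‖fibreMk X A x a‖) :=
    Submodule.Quotient.norm_mk_lt _ (sub_pos.2 h)
  rw [add_sub_cancel] at hbε
  have hk : a - b ∈ fibreIdeal X A x := (Submodule.Quotient.eq _).1 hb.symm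
  have hlim : ∀ᶠ χ in Cutoff.atPoint x, ‖χ.1 • (a - b)‖ < ε - ‖b‖ :=
    (Cutoff.tendsto_smul_atPoint hk).norm.eventually
      (gt_mem_nhds (by rw [norm_zero]; exact sub_pos.2 hbε))
  obtain ⟨U, hU, hUχ⟩ := Cutoff.eventually_atPoint.1 hlim
  obtain ⟨χ, hχ, h1, h0⟩ := exists_isCutoff_nhds hU
  refine ⟨χ, hχ, h1, ?_⟩
  calc ‖χ • a‖ = ‖χ • (a - b) + χ • b‖ := by rw [← smul_add', sub_add_cancel]
    _ ≤ ‖χ • (a - b)‖ + ‖χ • b‖ := norm_add_le _ _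
    _ < ε := by linarith [hUχ ⟨χ, hχ⟩ h0, hχ.norm_smul_le b]

variable [IsScalarTower ℂ A A] [SMulCommClass ℂ A A]

theorem eventually_norm_fibreMk_lt {x : X} {a : A} {ε : ℝ} (h : ‖fibreMk X A x a‖ < ε) :
    ∀ᶠ v in 𝓝 x, ‖fibreMk X A v a‖ < ε := by
  obtain ⟨χ, -, h1, hχ⟩ := exists_isCutoff_norm_smul_lt h
  filter_upwards [h1] with v hv
  calc ‖fibreMk X A v a‖ = ‖fibreMk X A v (χ • a)‖ := by rw [fibreMk_smul, hv, one_smul]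
    _ ≤ ‖χ • a‖ := norm_fibreMk_le X A v _
    _ < ε := hχ

variable [CompleteSpace A]

/- If `b_x` is a left quasi-inverse of `a_x`, then `c = b + a + b a` is small after multiplication
by a cut-off `χ` around `x`, so `1 + χ c` has an inverse `1 + e`; on functions supported where
`χ = 1`, the left inverse of `1 + a` is `(1 + e) (1 + b)`. -/
theorem exists_invertsLeft {a b : A} {x : X} (h : fibreMk X A x (b + a + b * a) = 0) :
    ∃ ψ : C₀(X, ℂ), IsCutoff ψ ∧ InvertsLeft a ψ ∧ ∀ᶠ v in 𝓝 x, ψ v = 1 := by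
  set c := b + a + b * a with hc
  obtain ⟨χ, -, hχ1, hχc⟩ := exists_isCutoff_norm_smul_lt (show ‖fibreMk X A x c‖ < 1 by simp [h])
  obtain ⟨e, -, he⟩ := isQuasiregular_iff.1 (isQuasiregular_of_norm_lt_one hχc)
  obtain ⟨ψ, hψ, hψ1, hψ0⟩ := exists_isCutoff_nhds hχ1
  refine ⟨ψ, hψ, fun d => ⟨ψ • d + ψ • d * e + ψ • d * b + ψ • d * e * b, ?_⟩, hψ1⟩
  have hχψ : χ * ψ = ψ := by
    ext v
    by_cases hv : χ v = 1
    · simp [hv]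
    · simp [hψ0 v hv]
  set D := ψ • d with hD
  have hχD : χ • D = D := by rw [hD, ← mul_smul', hχψ]
  have hDc : D * (χ • c) = D * c := by rw [← mul_smul_comm', smul_mul', hχD]
  have hDec : D * e * (χ • c) = D * e * c := by rw [← mul_smul_comm', smul_mul', smul_mul', hχD]
  have hinv : D * e + D * c + D * e * c = 0 := by
    rw [← hDc, ← hDec, mul_assoc, ← mul_add, ← mul_add, add_comm e, he, mul_zero]
  calc D = D + (D * e + D * c + D * e * c) := by rw [hinv, add_zero]
    _ = _ := by rw [hc]; noncomm_ring

theorem exists_left_quasiInverse (a : A)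
    (h : ∀ x : X, ∃ b : A, fibreMk X A x (b + a + b * a) = 0) : ∃ b : A, b + a + b * a = 0 := by
  obtain ⟨K, hK, hKa⟩ := exists_isCompact_norm_sub_smul_lt X a one_pos
  obtain ⟨χ, ⟨hχ, hχa⟩, hχ1⟩ :
      ∃ χ : C₀(X, ℂ), (IsCutoff χ ∧ InvertsLeft a χ) ∧ ∀ v ∈ K, χ v = 1 := by
    refine exists_eq_one_on_isCompact hK ⟨.zero, fun d => ⟨0, by simp [zero_smul']⟩⟩
      (fun χ ψ hχ hψ => ⟨hχ.1.union hψ.1, hχ.2.union hψ.2⟩) fun x _ => ?_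
    obtain ⟨b, hb⟩ := h x
    obtain ⟨ψ, hψ, hψa, hψ1⟩ := exists_invertsLeft hb
    exact ⟨ψ, ⟨hψ, hψa⟩, hψ1⟩
  obtain ⟨b, hb⟩ := hχa a
  obtain ⟨e, -, he⟩ := isQuasiregular_iff.1 (isQuasiregular_of_norm_lt_one (hKa χ hχ hχ1))
  refine ⟨e - b - e * b, ?_⟩
  rw [hb] at he
  rw [← he]
  noncomm_ring

variable (X) in
theorem isQuasiregular_iff_forall_fibre (a : A) :
    IsQuasiregular a ↔ ∀ x : X, IsQuasiregular (fibreMk X A x a) := by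
  refine ⟨fun h x => ?_, fun h => ?_⟩
  · obtain ⟨b, h1, h2⟩ := isQuasiregular_iff.1 h
    refine isQuasiregular_iff.2 ⟨fibreMk X A x b, ?_, ?_⟩
    · rw [← fibreMk_mul, ← map_add, ← map_add, h1, map_zero]
    · rw [← fibreMk_mul, ← map_add, ← map_add, h2, map_zero]
  · choose y hy hy' using fun x => isQuasiregular_iff.1 (h x)
    obtain ⟨b, hb⟩ := exists_left_quasiInverse (X := X) a fun x => by
      obtain ⟨b, hb⟩ := fibreMk_surjective X A x (y x)
      exact ⟨b, by rw [map_add, map_add, fibreMk_mul, hb, add_comm (y x), hy']⟩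
    have hby (x : X) : fibreMk X A x b = y x := by
      refine left_quasiInverse_eq_right_quasiInverse (a := fibreMk X A x a) ?_ ?_
      · rw [← fibreMk_mul, ← map_add, ← map_add, hb, map_zero]
      · rw [add_comm (fibreMk X A x a), hy]
    obtain ⟨c, hc⟩ := exists_left_quasiInverse (X := X) b fun x =>
      ⟨a, by rw [map_add, map_add, fibreMk_mul, hby, add_comm (fibreMk X A x a), hy]⟩
    have hca : c = a := left_quasiInverse_eq_right_quasiInverse hc hb
    exact isQuasiregular_iff.2 ⟨b, by rw [← hca, add_comm b, hc], by rw [add_comm a, hb]⟩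

end FibreDetection

section DenseSections

variable {X A : Type*} [TopologicalSpace X] [NonUnitalNormedRing A] [NormedSpace ℂ A]
  [IsScalarTower ℂ A A] [SMulCommClass ℂ A A] [C0BanachAlgebra X A]

/-- The functions `χ ∈ C₀(X)` for which `χ ξ` is approximated by a section in `S` up to an error of
`χ δ`. The weight `χ` in the error makes this property pass to the partitions of unity hidden in
`exists_eq_one_on_isCompact`. -/
def IsApproximable (S : Set (Gelfand X A)) (ξ : Gelfand X A) (δ : ℝ) (χ : C₀(X, ℂ)) : Prop :=
  ∃ ζ ∈ S, ∀ v, ‖χ v • ξ.1 v - ζ.1 v‖ ≤ ‖χ v‖ * δ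

variable {S : AddSubgroup (Gelfand X A)} {ξ : Gelfand X A} {δ : ℝ}

theorem IsApproximable.union (hS : ∀ χ : C₀(X, ℂ), ∀ ζ ∈ S, χ • ζ ∈ S) {χ ψ : C₀(X, ℂ)}
    (hχ : IsCutoff χ) (hψ : IsCutoff ψ) (h : IsApproximable S ξ δ χ)
    (h' : IsApproximable S ξ δ ψ) : IsApproximable S ξ δ (χ + (ψ - χ * ψ)) := by
  obtain ⟨ζ, hζ, hχζ⟩ := h
  obtain ⟨η, hη, hψη⟩ := h'
  refine ⟨ζ + (η - χ • η), S.add_mem hζ (S.sub_mem hη (hS χ η hη)), fun v => ?_⟩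
  have e : (χ + (ψ - χ * ψ)) v • ξ.1 v - (ζ + (η - χ • η)).1 v =
      (χ v • ξ.1 v - ζ.1 v) + (1 - χ v) • (ψ v • ξ.1 v - η.1 v) := by
    change (χ v + (ψ v - χ v * ψ v)) • ξ.1 v - (ζ.1 v + (η.1 v - χ v • η.1 v)) = _
    module
  calc _ ≤ ‖χ v • ξ.1 v - ζ.1 v‖ + ‖1 - χ v‖ * ‖ψ v • ξ.1 v - η.1 v‖ := by
        rw [e, ← norm_smul]
        exact norm_add_le _ _
    _ ≤ ‖χ v‖ * δ + ‖1 - χ v‖ * (‖ψ v‖ * δ) := by gcongr; exacts [hχζ v, hψη v]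
    _ = ‖(χ + (ψ - χ * ψ)) v‖ * δ := by rw [hχ.norm_union_apply hψ]; ring

variable [LocallyCompactSpace X] [RegularSpace X]

theorem IsContSection.eventually_norm_lt {ξ : ∀ x : X, Fibre X A x} (hξ : IsContSection X A ξ)
    {x : X} {ε : ℝ} (h : ‖ξ x‖ < ε) : ∀ᶠ v in 𝓝 x, ‖ξ v‖ < ε := by
  obtain ⟨a, ha⟩ := hξ x ((ε - ‖ξ x‖) / 3) (by linarith)
  have hax : ‖fibreMk X A x a‖ < ‖ξ x‖ + 2 * ((ε - ‖ξ x‖) / 3) := by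
    linarith [norm_le_norm_add_norm_sub (ξ x) (fibreMk X A x a), ha.self_of_nhds]
  filter_upwards [ha, eventually_norm_fibreMk_lt hax] with v hv hv'
  linarith [norm_le_norm_add_norm_sub' (ξ v) (fibreMk X A v a)]

theorem exists_isApproximable (hS : ∀ χ : C₀(X, ℂ), ∀ ζ ∈ S, χ • ζ ∈ S) {x : X}
    (h : Dense ((fun ζ : Gelfand X A => ζ.1 x) '' S)) (ξ : Gelfand X A) (hδ : 0 < δ) :
    ∃ χ : C₀(X, ℂ), (IsCutoff χ ∧ IsApproximable S ξ δ χ) ∧ ∀ᶠ v in 𝓝 x, χ v = 1 := by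
  obtain ⟨_, hζδ, ζ, hζ, rfl⟩ := Metric.dense_iff.1 h (ξ.1 x) δ hδ
  rw [mem_ball_iff_norm'] at hζδ
  obtain ⟨χ, hχ, hχ1, hχ0⟩ := exists_isCutoff_nhds ((ξ - ζ).2.1.eventually_norm_lt hζδ)
  refine ⟨χ, ⟨hχ, χ • ζ, hS χ ζ hζ, fun v => ?_⟩, hχ1⟩
  change ‖χ v • ξ.1 v - χ v • ζ.1 v‖ ≤ ‖χ v‖ * δ
  rw [← smul_sub, norm_smul]
  by_cases hv : ‖ξ.1 v - ζ.1 v‖ < δ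
  · gcongr
  · simp [hχ0 v hv]

theorem dense_of_forall_dense_eval (hS : ∀ χ : C₀(X, ℂ), ∀ ζ ∈ S, χ • ζ ∈ S)
    (h : ∀ x, Dense ((fun ζ : Gelfand X A => ζ.1 x) '' S)) : Dense (S : Set (Gelfand X A)) := by
  refine Metric.dense_iff.2 fun ξ ε hε => ?_
  obtain ⟨K, hK, hKξ⟩ := Filter.mem_cocompact.1 (ξ.2.2.eventually (gt_mem_nhds (half_pos hε)))
  have h0 : IsApproximable S ξ (ε / 2) 0 := ⟨0, S.zero_mem, fun v => by
    change ‖(0 : ℂ) • ξ.1 v - 0‖ ≤ ‖(0 : ℂ)‖ * (ε / 2)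
    simp⟩
  obtain ⟨χ, ⟨hχ, ζ, hζ, hχζ⟩, hχ1⟩ := exists_eq_one_on_isCompact hK ⟨.zero, h0⟩
    (fun χ ψ hχ hψ => ⟨hχ.1.union hψ.1, hχ.2.union hS hχ.1 hψ.1 hψ.2⟩)
    fun x _ => exists_isApproximable hS (h x) ξ (half_pos hε)
  refine ⟨ζ, ?_, hζ⟩
  rw [mem_ball_iff_norm']
  refine (Gelfand.norm_le (half_pos hε).le fun v => ?_).trans_lt (half_lt_self hε)
  have hv : ‖1 - χ v‖ * ‖ξ.1 v‖ ≤ ‖1 - χ v‖ * (ε / 2) := by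
    by_cases hvK : v ∈ K
    · simp [hχ1 v hvK]
    · gcongr
      exact (hKξ hvK : ‖ξ.1 v‖ < ε / 2).le
  calc ‖ξ.1 v - ζ.1 v‖ = ‖(1 - χ v) • ξ.1 v + (χ v • ξ.1 v - ζ.1 v)‖ := by congr 1; module
    _ ≤ ‖1 - χ v‖ * (ε / 2) + ‖χ v‖ * (ε / 2) :=
        norm_add_le_of_le (by rwa [norm_smul]) (hχζ v)
    _ = ε / 2 := by rw [← add_mul, add_comm, hχ.norm_apply_add_norm_one_sub_apply, one_mul]

end DenseSections

section Isoradial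

variable {X A : Type*} [TopologicalSpace X] [LocallyCompactSpace X] [RegularSpace X]
  [NonUnitalNormedRing A] [NormedSpace ℂ A] [IsScalarTower ℂ A A] [SMulCommClass ℂ A A]
  [CompleteSpace A] [C0BanachAlgebra X A]

variable (X) in
theorem banachSpectralRadius_eq_iSup (a : A) :
    banachSpectralRadius a = ⨆ x : X, banachSpectralRadius (fibreMk X A x a) := by
  refine eq_of_forall_ge_iff fun r => ?_
  rw [iSup_le_iff]
  simp only [banachSpectralRadius_le_iff]
  rw [forall_comm]
  refine forall_congr' fun z => ?_
  rw [isQuasiregular_iff_forall_fibre X, not_forall, forall_exists_index]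
  simp only [Units.smul_def, map_neg, map_smul]

theorem isIsoradial_of_forall_fibreMap {B : Type*} [NonUnitalNormedRing B] [NormedSpace ℂ B]
    [IsScalarTower ℂ B B] [SMulCommClass ℂ B B] [CompleteSpace B] [C0BanachAlgebra X B]
    (φ : ContractiveHom X A B) (h : ∀ x, IsIsoradial (φ.fibreMap x)) :
    IsIsoradial φ.toNonUnitalAlgHom where
  norm_map_le := φ.norm_map_le'
  radius_map a := by
    rw [banachSpectralRadius_eq_iSup X, banachSpectralRadius_eq_iSup X a]
    refine iSup_congr fun x => ?_
    rw [← φ.fibreMap_mk]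
    exact (h x).radius_map _

end Isoradial

section GelfandHom

variable {X A B : Type*} [TopologicalSpace X] [LocallyCompactSpace X] [T2Space X]
  [NonUnitalNormedRing A] [NormedSpace ℂ A] [IsScalarTower ℂ A A] [SMulCommClass ℂ A A]
  [C0BanachAlgebra X A] [NonUnitalNormedRing B] [NormedSpace ℂ B] [IsScalarTower ℂ B B]
  [SMulCommClass ℂ B B] [C0BanachAlgebra X B]

theorem denseRange_gelfandHom_comp (φ : ContractiveHom X A B)
    (h : ∀ x, DenseRange (φ.fibreMap x)) :
    DenseRange ((gelfandHom X B).toNonUnitalAlgHom.comp φ.toNonUnitalAlgHom) := by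
  let ψ := (gelfandHom X B).toNonUnitalAlgHom.comp φ.toNonUnitalAlgHom
  have hψ (χ : C₀(X, ℂ)) (a : A) : χ • ψ a = ψ (χ • a) :=
    ((gelfandHom X B).map_C0_smul' χ _).symm.trans
      (congrArg (gelfandHom X B).toNonUnitalAlgHom (φ.map_C0_smul' χ a).symm)
  refine dense_of_forall_dense_eval (S := AddMonoidHom.range (ψ : A →+ Gelfand X B)) ?_ fun x => ?_
  · rintro χ _ ⟨a, rfl⟩
    exact ⟨χ • a, (hψ χ a).symm⟩
  · refine (h x).mono ?_
    rintro _ ⟨p, rfl⟩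
    obtain ⟨a, rfl⟩ := fibreMk_surjective X A x p
    exact ⟨ψ a, ⟨a, rfl⟩, (φ.fibreMap_mk x a).symm⟩

variable (X A) in
theorem denseRange_gelfandHom : DenseRange (gelfandHom X A).toNonUnitalAlgHom := by
  refine dense_of_forall_dense_eval
    (S := AddMonoidHom.range ((gelfandHom X A).toNonUnitalAlgHom : A →+ Gelfand X A)) ?_ fun x => ?_
  · rintro χ _ ⟨a, rfl⟩
    exact ⟨χ • a, (gelfandHom X A).map_C0_smul' χ a⟩
  · convert dense_univ
    refine Set.eq_univ_of_forall fun p => ?_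
    obtain ⟨a, rfl⟩ := fibreMk_surjective X A x p
    exact ⟨_, ⟨a, rfl⟩, rfl⟩

variable [CompleteSpace A]

variable (X A) in
theorem isIsoradial_gelfandHom : IsIsoradial (gelfandHom X A).toNonUnitalAlgHom := by
  refine isIsoradial_of_isQuasiregular_imp _ (gelfandHom X A).norm_map_le' fun a h => ?_
  refine (isQuasiregular_iff_forall_fibre X a).2 fun x => ?_
  obtain ⟨η, h1, h2⟩ := isQuasiregular_iff.1 h
  exact isQuasiregular_iff.2 ⟨η.1 x, congrArg (fun ζ : Gelfand X A => ζ.1 x) h1,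
    congrArg (fun ζ : Gelfand X A => ζ.1 x) h2⟩

variable (X A) in
theorem isFull_gelfandHom : IsFull (gelfandHom X A).toNonUnitalAlgHom where
  toIsIsoradial := isIsoradial_gelfandHom X A
  denseRange := denseRange_gelfandHom X A

end GelfandHom

end C0BanachAlgebra

section SpectralRadius

theorem summable_norm_pow_mul_pow {T : Type*} [NormedRing T] [NormedAlgebra ℂ T] [CompleteSpace T]
    {c : T} {r : NNReal} (h : r < (spectralRadius ℂ c)⁻¹) :
    Summable fun n : ℕ => ‖c ^ n‖ * (r : ℝ) ^ n := by
  obtain ⟨s, hrs, hs⟩ := ENNReal.lt_iff_exists_nnreal_btwn.1 h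
  let p : FormalMultilinearSeries ℂ ℂ T := fun n => .mkPiRing ℂ (Fin n) (c ^ n)
  have hp : (s : ℝ≥0∞) ≤ p.radius :=
    ((spectrum.hasFPowerSeriesOnBall_inverse_one_sub_smul ℂ c).exchange_radius
      ((spectrum.differentiableOn_inverse_one_sub_smul hs).hasFPowerSeriesOnBall
        (pos_of_gt (ENNReal.coe_lt_coe.1 hrs)))).r_le
  simpa [p] using p.summable_norm_mul_pow (hrs.trans_le hp)

theorem spectralRadius_map_of_isLocalHom {R T U : Type*} [NormedField R] [Ring T] [Algebra R T]
    [Ring U] [Algebra R U] (f : T →ₐ[R] U) [IsLocalHom f] (c : T) :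
    spectralRadius R (f c) = spectralRadius R c := by
  have : spectrum R (f c) = spectrum R c := by
    ext z
    rw [spectrum.mem_iff, spectrum.mem_iff, ← f.commutes, ← map_sub, isUnit_map_iff f]
  rw [spectralRadius, spectralRadius, this]

theorem spectralRadius_le_norm_mul_norm_one {𝕜 U : Type*} [NormedField 𝕜] [NormedRing U]
    [NormedAlgebra 𝕜 U] [CompleteSpace U] (c : U) :
    spectralRadius 𝕜 c ≤ ENNReal.ofReal (‖c‖ * ‖(1 : U)‖) := by
  refine iSup₂_le fun z hz => ?_
  rw [← enorm_eq_nnnorm, ← ofReal_norm]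
  exact ENNReal.ofReal_le_ofReal (spectrum.norm_le_norm_mul_of_mem hz)

end SpectralRadius

section InvSqrt

-- The generating function `B = ∑ centralBinom n Xⁿ` satisfies `(1 - 4 X) B' = 2 B`, so that
-- `(1 - 4 X) B²` has derivative zero.
theorem sum_antidiagonal_centralBinom_mul_centralBinom (n : ℕ) :
    ∑ p ∈ Finset.HasAntidiagonal.antidiagonal n, p.1.centralBinom * p.2.centralBinom = 4 ^ n := by
  let B : PowerSeries ℚ := .mk fun n => n.centralBinom
  let D : PowerSeries ℚ := 1 - (4 : ℚ) • .X
  have hB : D * PowerSeries.derivative ℚ B = B + B := by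
    ext n
    have h : ((n : ℚ) + 1) * (n + 1).centralBinom = 2 * (2 * n + 1) * n.centralBinom := by
      exact_mod_cast Nat.succ_mul_centralBinom_succ n
    rcases n with _ | n
    · simpa [B, D, sub_mul, -PowerSeries.coeff_zero_eq_constantCoeff, PowerSeries.coeff_derivative,
        PowerSeries.coeff_zero_X_mul, one_add_one_eq_two] using h
    · simp only [B, D, sub_mul, one_mul, smul_mul_assoc, map_sub, PowerSeries.coeff_smul,
        PowerSeries.coeff_succ_X_mul, PowerSeries.coeff_derivative, PowerSeries.coeff_mk, map_add]
        at h ⊢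
      push_cast at h ⊢
      linear_combination h
  have hD : D * (B * B) = 1 := by
    refine PowerSeries.derivative.ext ?_ (by simp [B, D])
    have hD' : PowerSeries.derivative ℚ D = -4 := by
      simp [D, Algebra.smul_def]
      rfl
    simp only [Derivation.leibniz, smul_eq_mul, hD', Derivation.map_one_eq_zero]
    linear_combination 2 * B * hB
  have hBB : PowerSeries.coeff n (B * B) = 4 ^ n := by
    induction n with
    | zero => simp [B]
    | succ n ih =>
      have h := congrArg (PowerSeries.coeff (n + 1)) hD
      rw [sub_mul, one_mul, map_sub, smul_mul_assoc, PowerSeries.coeff_smul,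
        PowerSeries.coeff_succ_X_mul, ih, PowerSeries.coeff_one, if_neg n.succ_ne_zero] at h
      rw [pow_succ']
      exact sub_eq_zero.1 h
  simp only [PowerSeries.coeff_mul, B, PowerSeries.coeff_mk] at hBB
  exact_mod_cast hBB

variable {T : Type*} [NormedRing T]

/-- The power series of `(1 - 4 c) ^ (-1 / 2)`. -/
noncomputable def invSqrtOneSubFourMul (c : T) : T := ∑' n : ℕ, n.centralBinom • c ^ n

theorem norm_centralBinom_smul_pow_le (c : T) (n : ℕ) :
    ‖n.centralBinom • c ^ n‖ ≤ ‖c ^ n‖ * 4 ^ n := by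
  refine norm_nsmul_le.trans ?_
  rw [mul_comm]
  gcongr
  exact_mod_cast n.centralBinom_le_four_pow

variable [CompleteSpace T]

theorem norm_invSqrtOneSubFourMul_sub_one_le {c : T} (hc : ‖c‖ ≤ 8⁻¹) :
    ‖invSqrtOneSubFourMul c - 1‖ ≤ 8 * ‖c‖ := by
  have hbound (n : ℕ) : ‖(n + 1).centralBinom • c ^ (n + 1)‖ ≤ 4 * ‖c‖ * (1 / 2) ^ n :=
    calc _ ≤ ‖c ^ (n + 1)‖ * 4 ^ (n + 1) := norm_centralBinom_smul_pow_le c _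
      _ ≤ ‖c‖ * 8⁻¹ ^ n * 4 ^ (n + 1) := by
        refine mul_le_mul_of_nonneg_right ((norm_pow_le' c n.succ_pos).trans ?_) (by positivity)
        rw [pow_succ']
        gcongr
      _ = 4 * ‖c‖ * (1 / 2) ^ n := by
        rw [pow_succ, show (1 / 2 : ℝ) = 8⁻¹ * 4 by norm_num, mul_pow]
        ring
  have hs := hasSum_geometric_two.mul_left (4 * ‖c‖)
  have hsum : Summable fun n : ℕ => n.centralBinom • c ^ n :=
    (summable_nat_add_iff 1).1 (.of_norm_bounded hs.summable hbound)
  rw [invSqrtOneSubFourMul, hsum.tsum_eq_zero_add, Nat.centralBinom_zero, pow_zero, one_smul,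
    add_sub_cancel_left]
  exact (tsum_of_norm_bounded hs hbound).trans_eq (by ring)

theorem tendsto_invSqrtOneSubFourMul :
    Filter.Tendsto (invSqrtOneSubFourMul (T := T)) (𝓝 0) (𝓝 1) := by
  have h : Filter.Tendsto (fun c : T => ‖c‖) (𝓝 0) (𝓝 0) := by
    simpa using tendsto_norm (x := (0 : T))
  refine tendsto_iff_norm_sub_tendsto_zero.2
    (squeeze_zero' (.of_forall fun _ => norm_nonneg _) ?_ (by simpa using h.const_mul 8))
  filter_upwards [h.eventually (ge_mem_nhds (by positivity : (0 : ℝ) < 8⁻¹))] with c hc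
  exact norm_invSqrtOneSubFourMul_sub_one_le hc

variable [NormedAlgebra ℂ T] {c : T}

theorem summable_norm_centralBinom_smul_pow (h : spectralRadius ℂ c < 4⁻¹) :
    Summable fun n : ℕ => ‖n.centralBinom • c ^ n‖ :=
  .of_nonneg_of_le (fun _ => norm_nonneg _) (norm_centralBinom_smul_pow_le c) <| by
    simpa using summable_norm_pow_mul_pow (r := 4) (by simpa using ENNReal.lt_inv_iff_lt_inv.1 h)

theorem one_sub_four_mul_mul_invSqrt_mul_invSqrt (h : spectralRadius ℂ c < 4⁻¹) :
    (1 - 4 • c) * (invSqrtOneSubFourMul c * invSqrtOneSubFourMul c) = 1 := by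
  have hs := summable_norm_centralBinom_smul_pow h
  have hgeom : Summable fun n : ℕ => (4 • c) ^ n := by
    refine .of_norm_bounded (summable_norm_pow_mul_pow (r := 4) (c := c) ?_) fun n => ?_
    · exact ENNReal.lt_inv_iff_lt_inv.1 h
    · rw [smul_pow, mul_comm]
      simpa using norm_nsmul_le (n := 4 ^ n) (a := c ^ n)
  have hsq : invSqrtOneSubFourMul c * invSqrtOneSubFourMul c = ∑' n : ℕ, (4 • c) ^ n := by
    rw [invSqrtOneSubFourMul, tsum_mul_tsum_eq_tsum_sum_antidiagonal_of_summable_norm hs hs]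
    refine tsum_congr fun n => ?_
    rw [smul_pow, ← sum_antidiagonal_centralBinom_mul_centralBinom, Finset.sum_smul]
    refine Finset.sum_congr rfl fun p hp => ?_
    rw [smul_mul_smul_comm, ← pow_add, Finset.HasAntidiagonal.mem_antidiagonal.1 hp]
  rw [hsq, hgeom.one_sub_mul_tsum_pow]

theorem commute_invSqrtOneSubFourMul {a : T} (h : Commute a c) (hc : spectralRadius ℂ c < 4⁻¹) :
    Commute a (invSqrtOneSubFourMul c) := by
  have hs := (summable_norm_centralBinom_smul_pow hc).of_norm
  unfold Commute SemiconjBy invSqrtOneSubFourMul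
  rw [← hs.tsum_mul_left, ← hs.tsum_mul_right]
  exact tsum_congr fun n => (h.pow_right n).smul_right _

theorem map_invSqrtOneSubFourMul {U : Type*} [NormedRing U] (f : T →+* U) (hf : Continuous f)
    (hc : spectralRadius ℂ c < 4⁻¹) :
    f (invSqrtOneSubFourMul c) = invSqrtOneSubFourMul (f c) := by
  rw [invSqrtOneSubFourMul, (summable_norm_centralBinom_smul_pow hc).of_norm.map_tsum f hf,
    invSqrtOneSubFourMul]
  exact tsum_congr fun n => by simp

end InvSqrt

section InverseClosed

theorem isLocalHom_of_nhds_one {T U : Type*} [Ring T] [Ring U] [TopologicalSpace U]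
    [ContinuousMul U] (f : T →+* U) (hd : DenseRange f) {O : Set U} (hO : O ∈ 𝓝 1)
    (h : ∀ x, f x ∈ O → IsUnit x) : IsLocalHom f where
  map_nonunit x hx := by
    obtain ⟨u, hu⟩ := hx
    have hleft : Filter.Tendsto (fun y => f x * y) (𝓝 (↑u⁻¹ : U)) (𝓝 1) := by
      simpa [← hu] using (continuous_const_mul (f x)).tendsto (↑u⁻¹ : U)
    have hright : Filter.Tendsto (fun y => y * f x) (𝓝 (↑u⁻¹ : U)) (𝓝 1) := by
      simpa [← hu] using (continuous_mul_const (f x)).tendsto (↑u⁻¹ : U)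
    obtain ⟨_, ⟨hxy, hyx⟩, y, rfl⟩ := mem_closure_iff_nhds.1 (hd (↑u⁻¹ : U)) _
      ((hleft.eventually hO).and (hright.eventually hO))
    rw [← map_mul] at hxy hyx
    obtain ⟨v, hv⟩ := h _ hxy
    obtain ⟨w, hw⟩ := h _ hyx
    refine isUnit_iff_exists_and_exists.2 ⟨⟨y * ↑v⁻¹, ?_⟩, ⟨↑w⁻¹ * y, ?_⟩⟩
    · rw [← mul_assoc, ← hv, Units.mul_inv]
    · rw [mul_assoc, ← hw, Units.inv_mul]

end InverseClosed

section IdemLift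

variable {T : Type*} [NormedRing T] [NormedAlgebra ℂ T]

/-- The holomorphic functional calculus of `a` for the function that is `0` near `0` and `1` near
`1`, in the form `(1 + (2 a - 1) (1 - 4 (a - a²)) ^ (-1 / 2)) / 2`; it turns an approximate
idempotent `a` into an idempotent. -/
noncomputable def idemLift (a : T) : T :=
  (2⁻¹ : ℂ) • (1 + (2 * a - 1) * invSqrtOneSubFourMul (a - a * a))

variable [CompleteSpace T]

theorem isIdempotentElem_idemLift {a : T} (h : spectralRadius ℂ (a - a * a) < 4⁻¹) :
    IsIdempotentElem (idemLift a) := by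
  have hcomm : Commute (2 * a - 1) (invSqrtOneSubFourMul (a - a * a)) :=
    commute_invSqrtOneSubFourMul (by unfold Commute SemiconjBy; noncomm_ring) h
  have hsq : (2 * a - 1) * invSqrtOneSubFourMul (a - a * a) *
      ((2 * a - 1) * invSqrtOneSubFourMul (a - a * a)) = 1 := by
    have hdisc : (2 * a - 1) * (2 * a - 1) = 1 - 4 • (a - a * a) := by noncomm_ring
    rw [hcomm.symm.mul_mul_mul_comm, hdisc, one_sub_four_mul_mul_invSqrt_mul_invSqrt h]
  rw [IsIdempotentElem, idemLift, smul_mul_smul_comm, mul_add, mul_one, add_mul, one_mul, hsq]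
  module

theorem map_idemLift {U : Type*} [NormedRing U] [NormedAlgebra ℂ U] (f : T →ₐ[ℂ] U)
    (hf : Continuous f) {a : T} (h : spectralRadius ℂ (a - a * a) < 4⁻¹) :
    f (idemLift a) = idemLift (f a) := by
  have hs := map_invSqrtOneSubFourMul (f : T →+* U) hf h
  simp only [RingHom.coe_coe, map_sub, map_mul] at hs
  simp only [idemLift, map_smul, map_add, map_sub, map_mul, map_one, map_ofNat, hs]

theorem tendsto_idemLift {p : T} (hp : IsIdempotentElem p) :
    Filter.Tendsto idemLift (𝓝 p) (𝓝 p) := by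
  have hc : Filter.Tendsto (fun b : T => b - b * b) (𝓝 p) (𝓝 0) := by
    simpa [hp.eq] using (by fun_prop : Continuous fun b : T => b - b * b).tendsto p
  have hb : Filter.Tendsto (fun b : T => 2 * b - 1) (𝓝 p) (𝓝 (2 * p - 1)) :=
    (by fun_prop : Continuous fun b : T => 2 * b - 1).tendsto p
  have h := ((hb.mul (tendsto_invSqrtOneSubFourMul.comp hc)).const_add 1).const_smul (2⁻¹ : ℂ)
  rwa [mul_one, add_sub_cancel, two_mul, ← two_smul ℂ, inv_smul_smul₀ two_ne_zero] at h

theorem exists_isIdempotentElem_map_mem {U : Type*} [NormedRing U] [NormedAlgebra ℂ U]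
    [CompleteSpace U] (f : T →ₐ[ℂ] U) (hf : Continuous f) (hd : DenseRange f) [IsLocalHom f]
    {p : U} (hp : IsIdempotentElem p) {O : Set U} (hO : O ∈ 𝓝 p) :
    ∃ e : T, IsIdempotentElem e ∧ f e ∈ O := by
  have hc : Filter.Tendsto (fun b : U => ENNReal.ofReal (‖b - b * b‖ * ‖(1 : U)‖)) (𝓝 p) (𝓝 0) := by
    have : Continuous fun b : U => ENNReal.ofReal (‖b - b * b‖ * ‖(1 : U)‖) :=
      ENNReal.continuous_ofReal.comp (by fun_prop)
    simpa [hp.eq] using this.tendsto p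
  have hev := ((tendsto_idemLift hp).eventually hO).and
    (hc.eventually (gt_mem_nhds (by simp : (0 : ℝ≥0∞) < 4⁻¹)))
  obtain ⟨_, ⟨hmem, hnorm⟩, a, rfl⟩ := mem_closure_iff_nhds.1 (hd p) _ hev
  have hr : spectralRadius ℂ (a - a * a) < 4⁻¹ := by
    rw [← spectralRadius_map_of_isLocalHom f, map_sub, map_mul]
    exact (spectralRadius_le_norm_mul_norm_one _).trans_lt hnorm
  exact ⟨idemLift a, isIdempotentElem_idemLift hr, map_idemLift f hf hr ▸ hmem⟩

end IdemLift

section UnitsComponents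

theorem mem_of_map_mem_connectedComponentOfOne {G H : Type*} [Group G] [Group H]
    [TopologicalSpace H] [IsTopologicalGroup H] {F : G →* H} (hF : DenseRange F) {N : Subgroup G}
    {V : Set H} (hV : V ∈ 𝓝 1) (hVN : ∀ x, F x ∈ V → x ∈ N) {x : G}
    (hx : F x ∈ Subgroup.connectedComponentOfOne H) : x ∈ N := by
  let D := (N.map F).topologicalClosure
  have hVD : interior V ⊆ D := by
    refine (hF.open_subset_closure_inter isOpen_interior).trans (closure_mono ?_)
    rintro _ ⟨hw, y, rfl⟩
    exact ⟨y, hVN y (interior_subset hw), rfl⟩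
  have hDo : IsOpen (D : Set H) :=
    D.isOpen_of_mem_nhds (g := 1) (Filter.mem_of_superset (interior_mem_nhds.2 hV) hVD)
  have hxD : F x ∈ D := IsClopen.connectedComponent_subset
    ⟨Subgroup.isClosed_topologicalClosure _, hDo⟩ (one_mem D) hx
  have hdiv : Filter.Tendsto (fun w => F x * w⁻¹) (𝓝 (F x)) (𝓝 1) := by
    simpa using (by fun_prop : Continuous fun w => F x * w⁻¹).tendsto (F x)
  obtain ⟨_, hw, y, hy, rfl⟩ := mem_closure_iff_nhds.1 hxD _ (hdiv hV)
  have hxy : x * y⁻¹ ∈ N := hVN _ (by simpa using hw)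
  simpa using mul_mem hxy hy

theorem exists_inv_mul_mem_connectedComponentOfOne {G H : Type*} [Group H] [TopologicalSpace H]
    [IsTopologicalGroup H] [LocallyConnectedSpace H] {F : G → H} (hF : DenseRange F) (v : H) :
    ∃ u, v⁻¹ * F u ∈ Subgroup.connectedComponentOfOne H :=
  hF.exists_mem_open (isOpen_connectedComponent.preimage (continuous_const_mul v⁻¹))
    ⟨v, by simpa using mem_connectedComponent⟩

theorem denseRange_unitsMap {T U : Type*} [Monoid T] [NormedRing U] [CompleteSpace U]
    (f : T →* U) (hd : DenseRange f) [IsLocalHom f] : DenseRange (Units.map f) := by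
  refine dense_iff_inter_open.2 fun O hO ⟨v, hv⟩ => ?_
  obtain ⟨x, w, hw, hwx⟩ := hd.exists_mem_open (Units.isOpenMap_val _ hO) ⟨_, v, hv, rfl⟩
  have hx : IsUnit x := by
    rw [← isUnit_map_iff f, ← hwx]
    exact w.isUnit
  exact ⟨w, hw, hx.unit, Units.ext hwx.symm⟩

variable {T U : Type*} [NormedRing T] [NormedAlgebra ℂ T] [CompleteSpace T] [NormedRing U]
  [NormedAlgebra ℂ U] [CompleteSpace U]

theorem locallyConnectedSpace_units : LocallyConnectedSpace Tˣ :=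
  Units.isOpenEmbedding_val.locallyConnectedSpace

theorem mem_connectedComponentOfOne_of_segment {u : Tˣ}
    (h : ∀ t : unitInterval, IsUnit (1 + ((t : ℝ) : ℂ) • ((u : T) - 1))) :
    u ∈ Subgroup.connectedComponentOfOne Tˣ := by
  have hc : Continuous fun t => (h t).unit := by
    rw [Units.isOpenEmbedding_val.isInducing.continuous_iff]
    change Continuous fun t : unitInterval => 1 + ((t : ℝ) : ℂ) • ((u : T) - 1)
    fun_prop
  have h0 : (h 0).unit = 1 := Units.ext (by simp)
  have h1 : (h 1).unit = u := Units.ext (by simp)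
  exact (isPreconnected_range hc).subset_connectedComponent ⟨0, h0⟩ ⟨1, h1⟩

theorem isUnit_one_add_smul_sub_one {u : U} (hu : ‖u - 1‖ < 1) (t : unitInterval) :
    IsUnit (1 + ((t : ℝ) : ℂ) • (u - 1)) := by
  rw [← sub_neg_eq_add]
  refine isUnit_one_sub_of_norm_lt_one ?_
  rw [norm_neg, norm_smul, Complex.norm_real, Real.norm_of_nonneg t.2.1]
  exact (mul_le_of_le_one_left (norm_nonneg _) t.2.2).trans_lt hu

theorem mem_connectedComponentOfOne_of_norm_map_sub_one_lt (f : T →ₐ[ℂ] U) [IsLocalHom f] {u : Tˣ}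
    (hu : ‖f u - 1‖ < 1) : u ∈ Subgroup.connectedComponentOfOne Tˣ := by
  refine mem_connectedComponentOfOne_of_segment fun t => ?_
  rw [← isUnit_map_iff f, map_add, map_smul, map_sub, map_one]
  exact isUnit_one_add_smul_sub_one hu t

theorem mem_connectedComponentOfOne_of_unitsMap_mem (f : T →ₐ[ℂ] U) (hd : DenseRange f)
    [IsLocalHom f] {u : Tˣ}
    (hu : Units.map (f : T →* U) u ∈ Subgroup.connectedComponentOfOne Uˣ) :
    u ∈ Subgroup.connectedComponentOfOne Tˣ := by
  have hV : {w : Uˣ | ‖(w : U) - 1‖ < 1} ∈ 𝓝 1 :=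
    (isOpen_lt (by fun_prop) continuous_const).mem_nhds (by simp)
  exact mem_of_map_mem_connectedComponentOfOne (denseRange_unitsMap (f : T →* U) hd) hV
    (fun _ => mem_connectedComponentOfOne_of_norm_map_sub_one_lt f) hu

end UnitsComponents

section MatrixUnits

theorem tendsto_toBlocks₁₁_one {ι κ S : Type*} [DecidableEq ι] [DecidableEq κ] [Zero S] [One S]
    [TopologicalSpace S] :
    Filter.Tendsto (Matrix.toBlocks₁₁ : Matrix (ι ⊕ κ) (ι ⊕ κ) S → _) (𝓝 1) (𝓝 1) := by
  have hc : Continuous (Matrix.toBlocks₁₁ : Matrix (ι ⊕ κ) (ι ⊕ κ) S → _) :=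
    continuous_id.matrix_submatrix Sum.inl Sum.inl
  simpa [← Matrix.fromBlocks_one] using hc.tendsto 1

theorem denseRange_matrix_map {R S m n : Type*} [TopologicalSpace S] {f : R → S}
    (hd : DenseRange f) : DenseRange fun M : Matrix m n R => M.map f :=
  DenseRange.piMap fun _ => DenseRange.piMap fun _ => hd

variable {R S : Type*} [Ring R] [NormedRing S] {ι κ : Type*} [Fintype ι] [DecidableEq ι]
  [Fintype κ] [DecidableEq κ]

open scoped Matrix.Norms.Operator in
theorem completeSpace_matrix [CompleteSpace S] :
    @CompleteSpace (Matrix ι ι S) PseudoMetricSpace.toUniformSpace :=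
  inferInstanceAs (CompleteSpace (Matrix ι ι S))

theorem isUnit_matrix_mem_nhds_one [CompleteSpace S] :
    {M : Matrix ι ι S | IsUnit M} ∈ 𝓝 (1 : Matrix ι ι S) := by
  have := completeSpace_matrix (S := S) (ι := ι)
  open scoped Matrix.Norms.Operator in exact Units.nhds 1

theorem tendsto_matrix_ringInverse_one [CompleteSpace S] :
    Filter.Tendsto Ring.inverse (𝓝 (1 : Matrix ι ι S)) (𝓝 (1 : Matrix ι ι S)) := by
  have := completeSpace_matrix (S := S) (ι := ι)
  have h : Filter.Tendsto Ring.inverse (𝓝 (1 : Matrix ι ι S)) (𝓝 (Ring.inverse 1)) := by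
    open scoped Matrix.Norms.Operator in
    exact NormedRing.inverse_continuousAt (1 : (Matrix ι ι S)ˣ)
  rwa [Ring.inverse_one] at h

theorem isUnit_fromBlocks_one_zero (C : Matrix κ ι R) :
    IsUnit (Matrix.fromBlocks 1 0 C 1 : Matrix (ι ⊕ κ) (ι ⊕ κ) R) :=
  isUnit_iff_exists.2 ⟨Matrix.fromBlocks 1 0 (-C) 1, by simp [Matrix.fromBlocks_multiply],
    by simp [Matrix.fromBlocks_multiply]⟩

theorem isUnit_fromBlocks_zero_one (B : Matrix ι κ R) :
    IsUnit (Matrix.fromBlocks 1 B 0 1 : Matrix (ι ⊕ κ) (ι ⊕ κ) R) :=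
  isUnit_iff_exists.2 ⟨Matrix.fromBlocks 1 (-B) 0 1, by simp [Matrix.fromBlocks_multiply],
    by simp [Matrix.fromBlocks_multiply]⟩

theorem isUnit_fromBlocks_of_isUnit_schurComplement (A : (Matrix ι ι R)ˣ) (B : Matrix ι κ R)
    (C : Matrix κ ι R) (D : Matrix κ κ R) (h : IsUnit (D - C * (↑A⁻¹ : Matrix ι ι R) * B)) :
    IsUnit (Matrix.fromBlocks (A : Matrix ι ι R) B C D) := by
  obtain ⟨s, hs⟩ := h
  have hdiag : IsUnit (Matrix.fromBlocks (A : Matrix ι ι R) 0 0 (s : Matrix κ κ R)) :=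
    isUnit_iff_exists.2 ⟨Matrix.fromBlocks ↑A⁻¹ 0 0 ↑s⁻¹, by simp [Matrix.fromBlocks_multiply],
      by simp [Matrix.fromBlocks_multiply]⟩
  have hldu : Matrix.fromBlocks (A : Matrix ι ι R) B C D =
      Matrix.fromBlocks 1 0 (C * (↑A⁻¹ : Matrix ι ι R)) 1 *
        Matrix.fromBlocks (A : Matrix ι ι R) 0 0 (s : Matrix κ κ R) *
        Matrix.fromBlocks 1 ((↑A⁻¹ : Matrix ι ι R) * B) 0 1 := by
    have hB : (A : Matrix ι ι R) * ((↑A⁻¹ : Matrix ι ι R) * B) = B := by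
      rw [← Matrix.mul_assoc, Units.mul_inv, Matrix.one_mul]
    have hC : C * (↑A⁻¹ : Matrix ι ι R) * (A : Matrix ι ι R) = C := by
      rw [Matrix.mul_assoc, Units.inv_mul, Matrix.mul_one]
    simp only [Matrix.fromBlocks_multiply, Matrix.one_mul, Matrix.mul_one, Matrix.zero_mul,
      Matrix.mul_zero, add_zero, zero_add, hB, hC, hs]
    rw [← Matrix.mul_assoc C, add_sub_cancel]
  rw [hldu]
  exact ((isUnit_fromBlocks_one_zero _).mul hdiag).mul (isUnit_fromBlocks_zero_one _)

theorem tendsto_schurComplement_one {κ : Type*} [DecidableEq κ] [CompleteSpace S] :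
    Filter.Tendsto (fun N : Matrix (ι ⊕ κ) (ι ⊕ κ) S => N.toBlocks₂₂ -
      N.toBlocks₂₁ * Ring.inverse N.toBlocks₁₁ * N.toBlocks₁₂) (𝓝 1) (𝓝 1) := by
  have h₁₂ : Continuous (Matrix.toBlocks₁₂ : Matrix (ι ⊕ κ) (ι ⊕ κ) S → _) :=
    continuous_id.matrix_submatrix Sum.inl Sum.inr
  have h₂₁ : Continuous (Matrix.toBlocks₂₁ : Matrix (ι ⊕ κ) (ι ⊕ κ) S → _) :=
    continuous_id.matrix_submatrix Sum.inr Sum.inl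
  have h₂₂ : Continuous (Matrix.toBlocks₂₂ : Matrix (ι ⊕ κ) (ι ⊕ κ) S → _) :=
    continuous_id.matrix_submatrix Sum.inr Sum.inr
  have hinv := tendsto_matrix_ringInverse_one.comp
    (tendsto_toBlocks₁₁_one (ι := ι) (κ := κ) (S := S))
  have hpoly : Continuous fun q : Matrix κ κ S × Matrix κ ι S × Matrix ι ι S × Matrix ι κ S =>
      q.1 - q.2.1 * q.2.2.1 * q.2.2.2 := by fun_prop
  have h := (hpoly.tendsto _).comp ((h₂₂.tendsto 1).prodMk_nhds ((h₂₁.tendsto 1).prodMk_nhds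
    (hinv.prodMk_nhds (h₁₂.tendsto 1))))
  simpa [Function.comp_def, ← Matrix.fromBlocks_one] using h

/-- Matrices of size `ι` over `R` whose image under `f` is close to `1` are invertible. -/
def ReflectsUnitsNearOne (f : R →+* S) (ι : Type*) [Fintype ι] [DecidableEq ι] : Prop :=
  ∀ᶠ N in 𝓝 (1 : Matrix ι ι S), ∀ M : Matrix ι ι R, M.map f = N → IsUnit M

theorem ReflectsUnitsNearOne.sum [CompleteSpace S] {f : R →+* S} (h : ReflectsUnitsNearOne f ι)
    (h' : ReflectsUnitsNearOne f κ) : ReflectsUnitsNearOne f (ι ⊕ κ) := by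
  filter_upwards [tendsto_toBlocks₁₁_one.eventually h, tendsto_schurComplement_one.eventually h']
    with N hN hN' M hM
  subst hM
  obtain ⟨A, hA⟩ := hN M.toBlocks₁₁ rfl
  have hinv : Ring.inverse (M.map f).toBlocks₁₁ = (↑A⁻¹ : Matrix ι ι R).map f := by
    have hAf : (M.map f).toBlocks₁₁ = Units.map (f.mapMatrix (m := ι)).toMonoidHom A :=
      congrArg (Matrix.map · f) hA.symm
    rw [hAf, Ring.inverse_unit, ← map_inv]
    rfl
  have hschur := hN' (M.toBlocks₂₂ - M.toBlocks₂₁ * (↑A⁻¹ : Matrix ι ι R) * M.toBlocks₁₂) (by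
    rw [Matrix.map_sub _ (map_sub f), Matrix.map_mul, Matrix.map_mul, hinv]
    rfl)
  have := isUnit_fromBlocks_of_isUnit_schurComplement A _ _ _ hschur
  rwa [hA, Matrix.fromBlocks_toBlocks] at this

theorem ReflectsUnitsNearOne.of_equiv {f : R →+* S} (e : κ ≃ ι) (h : ReflectsUnitsNearOne f κ) :
    ReflectsUnitsNearOne f ι := by
  have hc : Continuous fun N : Matrix ι ι S => N.submatrix e e :=
    continuous_id.matrix_submatrix e e
  have ht := hc.tendsto 1
  rw [Matrix.submatrix_one_equiv] at ht
  filter_upwards [ht.eventually h] with N hN M hM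
  have hunit := hN (M.submatrix e e) (by rw [← Matrix.submatrix_map, hM])
  simpa using hunit.map (Matrix.reindexRingEquiv R e)

theorem reflectsUnitsNearOne_unique [Unique ι] [CompleteSpace S] (f : R →+* S) [IsLocalHom f] :
    ReflectsUnitsNearOne f ι := by
  obtain rfl : ‹Fintype ι› = Unique.fintype := Subsingleton.elim _ _
  have hc : Filter.Tendsto (Matrix.uniqueRingEquiv : Matrix ι ι S ≃+* S) (𝓝 1) (𝓝 1) := by
    have : Continuous fun N : Matrix ι ι S => N default default := by fun_prop
    have h := this.tendsto 1
    rwa [Matrix.one_apply_eq] at h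
  filter_upwards [hc.eventually (Units.nhds 1)] with N hN M hM
  subst hM
  refine (MulEquiv.isUnit_map (Matrix.uniqueRingEquiv : Matrix ι ι R ≃+* R)).1 ?_
  exact (isUnit_map_iff f _).1 hN

theorem reflectsUnitsNearOne [CompleteSpace S] (f : R →+* S) [IsLocalHom f] :
    ReflectsUnitsNearOne f ι := by
  suffices h : ∀ n, ReflectsUnitsNearOne f (Fin n) from (h _).of_equiv (Fintype.equivFin ι).symm
  intro n
  induction n with
  | zero => exact .of_forall fun N M _ => isUnit_of_subsingleton M
  | succ n ih =>
    exact (ih.sum (κ := Fin 1) (reflectsUnitsNearOne_unique f)).of_equiv finSumFinEquiv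

theorem isLocalHom_mapMatrix [CompleteSpace S] (f : R →+* S) (hd : DenseRange f) [IsLocalHom f] :
    IsLocalHom (f.mapMatrix : Matrix ι ι R →+* Matrix ι ι S) :=
  isLocalHom_of_nhds_one _ (denseRange_matrix_map hd) (reflectsUnitsNearOne f) fun M hM => hM M rfl

theorem isLocalHom_algHomMapMatrix [CompleteSpace S] {k : Type*} [CommRing k] [Algebra k R]
    [Algebra k S] (f : R →ₐ[k] S) (hd : DenseRange f) [IsLocalHom f] :
    IsLocalHom (f.mapMatrix : Matrix ι ι R →ₐ[k] Matrix ι ι S) :=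
  have : IsLocalHom (f : R →+* S) := isLocalHom_toRingHom f
  ⟨(isLocalHom_mapMatrix (ι := ι) (f : R →+* S) hd).map_nonunit⟩

end MatrixUnits

theorem grothendieckAddGroup_lift_of {M G : Type*} [AddCommMonoid M] [AddCommGroup G] (f : M →+ G)
    (x : M) :
    Algebra.GrothendieckAddGroup.lift f (Algebra.GrothendieckAddGroup.of x) = f x :=
  DFunLike.congr_fun (Algebra.GrothendieckAddGroup.lift.symm_apply_apply f) x

theorem leftInverse_grothendieckAddGroup_lift {M N : Type*} [AddCommMonoid M] [AddCommMonoid N]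
    {k : N →+ M} {g : M →+ N} (h : Function.LeftInverse k g) :
    Function.LeftInverse
      (Algebra.GrothendieckAddGroup.lift (Algebra.GrothendieckAddGroup.of.comp k))
      (Algebra.GrothendieckAddGroup.lift (Algebra.GrothendieckAddGroup.of.comp g)) := by
  suffices hid : (Algebra.GrothendieckAddGroup.lift (Algebra.GrothendieckAddGroup.of.comp k)).comp
      (Algebra.GrothendieckAddGroup.lift (Algebra.GrothendieckAddGroup.of.comp g)) =
        AddMonoidHom.id _ from DFunLike.congr_fun hid
  refine Algebra.GrothendieckAddGroup.lift.symm.injective (AddMonoidHom.ext fun x => ?_)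
  simp only [Algebra.GrothendieckAddGroup.lift_symm_apply, AddMonoidHom.comp_apply,
    grothendieckAddGroup_lift_of, h x, AddMonoidHom.id_apply]

theorem bijective_grothendieckAddGroup_lift {M N : Type*} [AddCommMonoid M] [AddCommMonoid N]
    {g : M →+ N} (hg : Function.Bijective g) : Function.Bijective
      (Algebra.GrothendieckAddGroup.lift (Algebra.GrothendieckAddGroup.of.comp g)) := by
  let e := AddEquiv.ofBijective g hg
  have hl := leftInverse_grothendieckAddGroup_lift (k := (e.symm : N →+ M)) (g := (e : M →+ N))
    e.symm_apply_apply
  have hr := leftInverse_grothendieckAddGroup_lift (k := (e : M →+ N)) (g := (e.symm : N →+ M))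
    e.apply_symm_apply
  exact ⟨hl.injective, hr.surjective⟩

theorem directLimit_map_bijective {I : Type*} [Preorder I] [IsDirectedOrder I]
    {F₁ F₂ : I → Type*} {T₁ T₂ : ∀ ⦃i j : I⦄, i ≤ j → Type*}
    {f₁ : ∀ i j (h : i ≤ j), T₁ h} {f₂ : ∀ i j (h : i ≤ j), T₂ h}
    [∀ i j (h : i ≤ j), FunLike (T₁ h) (F₁ i) (F₁ j)]
    [∀ i j (h : i ≤ j), FunLike (T₂ h) (F₂ i) (F₂ j)]
    [DirectedSystem F₁ (f₁ · · ·)] [DirectedSystem F₂ (f₂ · · ·)] {ih : ∀ i, F₁ i → F₂ i}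
    (compat : ∀ i j h x, f₂ i j h (ih i x) = ih j (f₁ i j h x))
    (hih : ∀ i, Function.Bijective (ih i)) :
    Function.Bijective (DirectLimit.map f₁ f₂ ih compat) := by
  constructor
  · intro x y hxy
    induction x, y using DirectLimit.induction₂ with | _ i x y => ?_
    obtain ⟨k, hik, _, hk⟩ := Quotient.eq.1 hxy
    rw [compat, compat] at hk
    exact Quotient.sound ⟨k, hik, hik, (hih k).1 hk⟩
  · intro y
    induction y using DirectLimit.induction with | _ i y => ?_
    obtain ⟨x, rfl⟩ := (hih i).2 y
    exact ⟨⟦⟨i, x⟩⟧, rfl⟩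

namespace BanachK

section Idempotents

variable {ι κ : Type*} [Fintype ι] [Fintype κ]

section Algebraic

variable {R : Type*} [Ring R] [DecidableEq ι]

theorem idemEquiv_of_isUnit {p q : Matrix ι ι R} (hp : IsIdempotentElem p)
    (hq : IsIdempotentElem q) (h : IsUnit (q * p + (1 - q) * (1 - p))) : IdemEquiv q p := by
  obtain ⟨u, hu⟩ := h
  have hqu : q * (u : Matrix ι ι R) = q * p := by
    rw [hu, mul_add, ← mul_assoc, hq.eq, ← mul_assoc, hq.mul_one_sub_self, zero_mul, add_zero]
  have hup : (u : Matrix ι ι R) * p = q * p := by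
    rw [hu, add_mul, mul_assoc, hp.eq, mul_assoc, hp.one_sub_mul_self, mul_zero, add_zero]
  refine ⟨q * (u : Matrix ι ι R), (↑u⁻¹ : Matrix ι ι R) * q, ?_, ?_⟩
  · rw [mul_assoc, ← mul_assoc (u : Matrix ι ι R), Units.mul_inv, one_mul, hq.eq]
  · rw [mul_assoc, ← mul_assoc q, hq.eq, hqu, ← hup, ← mul_assoc, Units.inv_mul, one_mul]

theorem idemEquiv_of_isUnit_corners [DecidableEq κ] {e : Matrix ι ι R} {e' : Matrix κ κ R}
    (he : IsIdempotentElem e) (he' : IsIdempotentElem e') {a : Matrix ι κ R} {b : Matrix κ ι R}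
    (hea : e * a = a) (hae' : a * e' = a) (h : IsUnit (a * b + (1 - e)))
    (h' : IsUnit (b * a + (1 - e'))) : IdemEquiv e e' := by
  obtain ⟨u, hu⟩ := h
  obtain ⟨v, hv⟩ := h'
  have hab : a * b = e * (u : Matrix ι ι R) := by
    rw [hu, mul_add, ← Matrix.mul_assoc, hea, he.mul_one_sub_self, add_zero]
  have hba : b * a = (v : Matrix κ κ R) * e' := by
    rw [hv, add_mul, Matrix.mul_assoc, hae', he'.one_sub_mul_self, add_zero]
  have habu : a * (b * (↑u⁻¹ : Matrix ι ι R)) = e := by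
    rw [← Matrix.mul_assoc, hab, mul_assoc, Units.mul_inv, mul_one]
  have hvba : (↑v⁻¹ : Matrix κ κ R) * b * a = e' := by
    rw [Matrix.mul_assoc, hba, ← mul_assoc, Units.inv_mul, one_mul]
  refine ⟨a, e' * (b * (↑u⁻¹ : Matrix ι ι R)), ?_, ?_⟩
  · rw [← Matrix.mul_assoc, hae', habu]
  · calc e' * (b * (↑u⁻¹ : Matrix ι ι R)) * a
        = (↑v⁻¹ : Matrix κ κ R) * b * (a * (b * (↑u⁻¹ : Matrix ι ι R))) * a := by
          rw [← hvba]; simp only [Matrix.mul_assoc]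
      _ = e' := by rw [habu, Matrix.mul_assoc, hea, hvba]

theorem corner_mul_corner_add_one_sub {e : Matrix ι ι R} {e' : Matrix κ κ R}
    (he : IsIdempotentElem e) {x : Matrix ι κ R} {y : Matrix κ ι R} (hxy : x * y = e)
    (hyx : y * x = e') : (e * x * e') * (e' * y * e) + (1 - e) = 1 := by
  have hmul : (e * x * e') * (e' * y * e) = e := by
    calc (e * x * e') * (e' * y * e) = e * (x * y) * (x * y) * (x * y) * e := by
          rw [← hyx]; simp only [Matrix.mul_assoc]
      _ = e := by simp only [hxy, he.eq]
  rw [hmul, add_sub_cancel]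

end Algebraic

variable {S : Type*} [NormedRing S] [CompleteSpace S]

theorem eventually_idemEquiv {p : Matrix ι ι S} (hp : IsIdempotentElem p) :
    ∀ᶠ q in 𝓝 p, IsIdempotentElem q → IdemEquiv q p := by
  classical
  have hc : Continuous fun q : Matrix ι ι S => q * p + (1 - q) * (1 - p) := by fun_prop
  have ht := hc.tendsto p
  rw [hp.eq, hp.one_sub.eq, add_sub_cancel] at ht
  filter_upwards [ht.eventually isUnit_matrix_mem_nhds_one] with q hu hq
  exact idemEquiv_of_isUnit hp hq hu

theorem eventually_isUnit_corner [DecidableEq ι] {e : Matrix ι ι S} {e' : Matrix κ κ S}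
    (he : IsIdempotentElem e) {x : Matrix ι κ S} {y : Matrix κ ι S} (hxy : x * y = e)
    (hyx : y * x = e') :
    ∀ᶠ q in 𝓝 (x, y), IsUnit ((e * q.1 * e') * (e' * q.2 * e) + (1 - e)) := by
  have hc : Continuous fun q : Matrix ι κ S × Matrix κ ι S =>
      (e * q.1 * e') * (e' * q.2 * e) + (1 - e) := by fun_prop
  have ht := hc.tendsto (x, y)
  simp only [corner_mul_corner_add_one_sub he hxy hyx] at ht
  exact ht.eventually isUnit_matrix_mem_nhds_one

theorem idemEquiv_of_map {R : Type*} [Ring R] (f : R →+* S) (hd : DenseRange f) [IsLocalHom f]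
    {e : Matrix ι ι R} {e' : Matrix κ κ R} (he : IsIdempotentElem e) (he' : IsIdempotentElem e')
    (h : IdemEquiv (e.map f) (e'.map f)) : IdemEquiv e e' := by
  classical
  obtain ⟨x, y, hxy, hyx⟩ := h
  have hef : IsIdempotentElem (e.map f) := he.map (f.mapMatrix (m := ι))
  have hef' : IsIdempotentElem (e'.map f) := he'.map (f.mapMatrix (m := κ))
  have hunits := (eventually_isUnit_corner hef hxy hyx).and
    ((continuous_swap.tendsto (x, y)).eventually (eventually_isUnit_corner hef' hyx hxy))
  have hdense := (denseRange_matrix_map (m := ι) (n := κ) hd).prodMap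
    (denseRange_matrix_map (m := κ) (n := ι) hd)
  obtain ⟨_, ⟨hu, hv⟩, ⟨x₀, y₀⟩, rfl⟩ := mem_closure_iff_nhds.1 (hdense (x, y)) _ hunits
  refine idemEquiv_of_isUnit_corners he he' (a := e * x₀ * e') (b := e' * y₀ * e) ?_ ?_ ?_ ?_
  · rw [← Matrix.mul_assoc, ← Matrix.mul_assoc, he.eq]
  · rw [Matrix.mul_assoc, he'.eq]
  · refine (isLocalHom_mapMatrix f hd).map_nonunit _ ?_
    simpa [RingHom.mapMatrix_apply, Matrix.map_add, Matrix.map_sub, Matrix.map_mul] using hu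
  · refine (isLocalHom_mapMatrix f hd).map_nonunit _ ?_
    simpa [RingHom.mapMatrix_apply, Matrix.map_add, Matrix.map_sub, Matrix.map_mul] using hv

end Idempotents

section DenseLocal

variable {R S : Type*} [NormedRing R] [NormedAlgebra ℂ R] [CompleteSpace R]
  [NormedRing S] [NormedAlgebra ℂ S] [CompleteSpace S]

open scoped Matrix.Norms.Operator in
theorem exists_isIdempotentElem_idemEquiv_map (f : R →ₐ[ℂ] S) (hf : Continuous f)
    (hd : DenseRange f) [IsLocalHom f] {ι : Type*} [Fintype ι] {p : Matrix ι ι S}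
    (hp : IsIdempotentElem p) :
    ∃ e : Matrix ι ι R, IsIdempotentElem e ∧ IdemEquiv (e.map f) p := by
  classical
  have := completeSpace_matrix (S := R) (ι := ι)
  have := completeSpace_matrix (S := S) (ι := ι)
  have := isLocalHom_algHomMapMatrix (ι := ι) f hd
  obtain ⟨e, he, hep⟩ := exists_isIdempotentElem_map_mem (f.mapMatrix : Matrix ι ι R →ₐ[ℂ] _)
    (continuous_id.matrix_map hf) (denseRange_matrix_map hd) hp (eventually_idemEquiv hp)
  exact ⟨e, he, hep (he.map f.mapMatrix)⟩

theorem IdemClass.map_bijective (f : R →ₐ[ℂ] S) (hf : Continuous f) (hd : DenseRange f)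
    [IsLocalHom f] : Function.Bijective (IdemClass.map (f : R →+* S)) := by
  have : IsLocalHom (f : R →+* S) := isLocalHom_toRingHom f
  constructor
  · rintro ⟨e⟩ ⟨e'⟩ h
    exact Quotient.sound (idemEquiv_of_map (f : R →+* S) hd e.idem e'.idem (Quotient.exact h))
  · rintro ⟨p⟩
    obtain ⟨e, he, h⟩ := exists_isIdempotentElem_idemEquiv_map f hf hd p.idem
    exact ⟨Quotient.mk _ ⟨p.size, e, he⟩, Quotient.sound h⟩

theorem K0Unital.map_bijective (f : R →ₐ[ℂ] S) (hf : Continuous f) (hd : DenseRange f)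
    [IsLocalHom f] : Function.Bijective (K0Unital.map (f : R →+* S)) :=
  bijective_grothendieckAddGroup_lift (IdemClass.map_bijective f hf hd)

theorem Pi0GL.map_injective (f : R →ₐ[ℂ] S) (hf : Continuous f) (hd : DenseRange f)
    [IsLocalHom f] (n : ℕ) : Function.Injective (Pi0GL.map (f : R →+* S) hf n) := by
  have := completeSpace_matrix (S := R) (ι := Fin n)
  have := completeSpace_matrix (S := S) (ι := Fin n)
  have := isLocalHom_algHomMapMatrix (ι := Fin n) f hd
  have hdm : DenseRange (f.mapMatrix : Matrix (Fin n) (Fin n) R →ₐ[ℂ] _) :=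
    denseRange_matrix_map hd
  let F : GLn R n →* GLn S n :=
    Units.map ((f : R →+* S).mapMatrix : Matrix (Fin n) (Fin n) R →+* _).toMonoidHom
  have hF : ∀ u, F u ∈ Subgroup.connectedComponentOfOne (GLn S n) →
      u ∈ Subgroup.connectedComponentOfOne (GLn R n) := by
    open scoped Matrix.Norms.Operator in
    exact fun u hu => mem_connectedComponentOfOne_of_unitsMap_mem
      (T := Matrix (Fin n) (Fin n) R) f.mapMatrix hdm hu
  refine (injective_iff_map_eq_one _).2 fun x hx => ?_
  induction x using QuotientGroup.induction_on with | _ u => ?_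
  exact (QuotientGroup.eq_one_iff u).2 (hF u ((QuotientGroup.eq_one_iff (F u)).1 hx))

theorem Pi0GL.map_surjective {R : Type*} [NormedRing R] (f : R →+* S) (hf : Continuous f)
    (hd : DenseRange f) [IsLocalHom f] (n : ℕ) : Function.Surjective (Pi0GL.map f hf n) := by
  have := completeSpace_matrix (S := S) (ι := Fin n)
  have : IsLocalHom (f.mapMatrix : Matrix (Fin n) (Fin n) R →+* _).toMonoidHom :=
    ⟨(isLocalHom_mapMatrix f hd).map_nonunit⟩
  let F : GLn R n →* GLn S n :=
    Units.map (f.mapMatrix : Matrix (Fin n) (Fin n) R →+* _).toMonoidHom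
  have : LocallyConnectedSpace (GLn S n) := by
    open scoped Matrix.Norms.Operator in exact locallyConnectedSpace_units
  have hF : DenseRange F := by
    open scoped Matrix.Norms.Operator in
    exact denseRange_unitsMap (U := Matrix (Fin n) (Fin n) S) _ (denseRange_matrix_map hd)
  intro y
  induction y using QuotientGroup.induction_on with | _ v => ?_
  obtain ⟨u, hu⟩ := exists_inv_mul_mem_connectedComponentOfOne hF v
  exact ⟨(u : Pi0GL R n), (QuotientGroup.eq.2 hu).symm⟩

theorem stabPi0_map {R S : Type*} [NormedRing R] [NormedRing S] (f : R →+* S) (hf : Continuous f)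
    (n m : ℕ) (h : n ≤ m) (x : Pi0GL R n) :
    stabPi0 S n m h (Pi0GL.map f hf n x) = Pi0GL.map f hf m (stabPi0 R n m h x) := by
  induction x using QuotientGroup.induction_on with | _ u => ?_
  refine congrArg _ (Units.ext ?_)
  ext i j
  simp only [stabHom, RingHom.toMonoidHom_eq_coe, Units.coe_map, MonoidHom.coe_coe,
    RingHom.mapMatrix_apply, MonoidHom.coe_mk, OneHom.coe_mk, stabMatrix, Matrix.map_apply,
    Matrix.of_apply]
  split_ifs <;> simp

theorem K1Unital.map_bijective (f : R →ₐ[ℂ] S) (hf : Continuous f) (hd : DenseRange f)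
    [IsLocalHom f] : Function.Bijective (K1Unital.map (f : R →+* S) hf) :=
  have : IsLocalHom (f : R →+* S) := isLocalHom_toRingHom f
  directLimit_map_bijective (stabPi0_map (f : R →+* S) hf) fun n =>
    ⟨Pi0GL.map_injective f hf hd n, Pi0GL.map_surjective (f : R →+* S) hf hd n⟩

end DenseLocal

end BanachK

namespace BanachK

section NonUnital

variable {A B C : Type*} [NonUnitalNormedRing A] [NormedSpace ℂ A] [IsScalarTower ℂ A A]
  [SMulCommClass ℂ A A] [NonUnitalNormedRing B] [NormedSpace ℂ B] [IsScalarTower ℂ B B]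
  [SMulCommClass ℂ B B] [NonUnitalNormedRing C] [NormedSpace ℂ C] [IsScalarTower ℂ C C]
  [SMulCommClass ℂ C C]

theorem plusMap_comp (ψ : B →ₙₐ[ℂ] C) (φ : A →ₙₐ[ℂ] B) :
    plusMap (ψ.comp φ) = (plusMap ψ).comp (plusMap φ) := by
  ext x
  rw [RingHom.comp_apply, plusMap_apply, plusMap_apply, plusMap_apply]
  simp

theorem norm_plusMap_sub_one (φ : A →ₙₐ[ℂ] B) (x : Plus A) :
    ‖plusMap φ x - 1‖ = ‖(WithLp.ofLp x).fst - 1‖ + ‖φ (WithLp.ofLp x).snd‖ := by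
  have hfst : (WithLp.ofLp (1 : Plus B)).fst = 1 := rfl
  have hsnd : (WithLp.ofLp (1 : Plus B)).snd = 0 := rfl
  rw [WithLp.unitization_norm_def, plusMap_apply]
  simp [sub_eq_add_neg, hfst, hsnd]

/-- The unital extension `plusMap φ` as a homomorphism of `ℂ`-algebras. -/
noncomputable def plusAlgHom (φ : A →ₙₐ[ℂ] B) : Plus A →ₐ[ℂ] Plus B :=
  { plusMap φ with
    commutes' := AlgHom.commutes <|
      (WithLp.unitizationAlgEquiv (𝕜 := ℂ) (A := B) ℂ).symm.toAlgHom.comp <|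
        (Unitization.lift ((Unitization.inrNonUnitalAlgHom ℂ B).comp φ)).comp
          (WithLp.unitizationAlgEquiv (𝕜 := ℂ) (A := A) ℂ).toAlgHom }

theorem denseRange_plusMap (φ : A →ₙₐ[ℂ] B) (hd : DenseRange φ) : DenseRange (plusMap φ) := by
  refine Metric.dense_iff.2 fun y ε hε => ?_
  obtain ⟨a, ha⟩ := hd.exists_dist_lt (WithLp.ofLp y).snd hε
  refine ⟨_, ?_, WithLp.toLp 1 (Unitization.inl (WithLp.ofLp y).fst + Unitization.inr a), rfl⟩
  rw [Metric.mem_ball, dist_comm, dist_eq_norm, WithLp.unitization_norm_def, plusMap_apply]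
  rw [dist_eq_norm] at ha
  simpa [sub_eq_add_neg] using ha

theorem isUnit_inl_add_inr {z : ℂˣ} {a : A} (h : banachSpectralRadius (-a) < ‖(z : ℂ)‖₊) :
    IsUnit (Unitization.inl (z : ℂ) + Unitization.inr a : Unitization ℂ A) := by
  have hq := isQuasiregular_of_banachSpectralRadius_lt h
  rw [smul_neg, neg_neg, isQuasiregular_iff_isUnit' ℂ] at hq
  have hz : IsUnit (Unitization.inl (z : ℂ) : Unitization ℂ A) :=
    z.isUnit.map (Unitization.inlRingHom ℂ A)
  convert hz.mul hq using 1
  rw [mul_add, mul_one, Unitization.inl_mul_inr, Units.smul_def, smul_smul, Units.mul_inv, one_smul]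

theorem isUnit_of_norm_plusMap_sub_one_lt [CompleteSpace B] {φ : A →ₙₐ[ℂ] B}
    (hφ : IsIsoradial φ) {x : Plus A} (hx : ‖plusMap φ x - 1‖ < 1) : IsUnit x := by
  set z := (WithLp.ofLp x).fst with hz
  set a := (WithLp.ofLp x).snd with ha
  rw [norm_plusMap_sub_one, ← hz, ← ha] at hx
  have hlt : ‖φ a‖ < ‖z‖ := by
    have := norm_sub_norm_le (1 : ℂ) (1 - z)
    rw [norm_one, sub_sub_cancel, norm_sub_rev] at this
    linarith
  have hz0 : z ≠ 0 := norm_pos_iff.1 ((norm_nonneg _).trans_lt hlt)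
  have hr : banachSpectralRadius (-a) < ‖(Units.mk0 z hz0 : ℂ)‖₊ := by
    rw [← hφ.radius_map, map_neg]
    refine (banachSpectralRadius_le_norm _).trans_lt ?_
    rw [nnnorm_neg]
    exact_mod_cast hlt
  have hunit := isUnit_inl_add_inr hr
  rw [Units.val_mk0, hz, ha, Unitization.inl_fst_add_inr_snd_eq] at hunit
  exact hunit.map (WithLp.unitizationAlgEquiv (𝕜 := ℂ) (A := A) ℂ).symm

theorem isLocalHom_plusMap [CompleteSpace B] {φ : A →ₙₐ[ℂ] B} (hφ : IsFull φ) :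
    IsLocalHom (plusMap φ) :=
  isLocalHom_of_nhds_one _ (denseRange_plusMap φ hφ.denseRange) (Metric.ball_mem_nhds 1 one_pos)
    fun _ hx => isUnit_of_norm_plusMap_sub_one_lt hφ.toIsIsoradial (mem_ball_iff_norm.1 hx)

theorem K0.map_map (ψ : B →ₙₐ[ℂ] C) (φ : A →ₙₐ[ℂ] B) (x : K0 A) :
    K0.map ψ (K0.map φ x) = K0.map (ψ.comp φ) x := by
  refine Subtype.ext ((K0Unital.map_map _ _ _).trans ?_)
  rw [← plusMap_comp]
  rfl

theorem K1.map_map (ψ : B →ₙₐ[ℂ] C) (hψ : Continuous ψ) (φ : A →ₙₐ[ℂ] B) (hφ : Continuous φ)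
    (x : K1 A) : K1.map ψ hψ (K1.map φ hφ x) = K1.map (ψ.comp φ) (hψ.comp hφ) x := by
  refine Subtype.ext ((K1Unital.map_map _ _ _ _ _).trans ?_)
  simp only [← plusMap_comp]
  rfl

theorem K0.map_bijective {φ : A →ₙₐ[ℂ] B} (h : Function.Bijective (K0Unital.map (plusMap φ))) :
    Function.Bijective (K0.map φ) := by
  refine ⟨fun x y hxy => Subtype.ext (h.1 (congrArg Subtype.val hxy)), ?_⟩
  rintro ⟨y, hy⟩
  obtain ⟨x, rfl⟩ := h.2 y
  refine ⟨⟨x, ?_⟩, rfl⟩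
  change K0Unital.map (augmentation B) (K0Unital.map (plusMap φ) x) = 0 at hy
  rwa [K0Unital.map_map, augmentation_comp_plusMap] at hy

theorem K1.map_bijective {φ : A →ₙₐ[ℂ] B} (hφ : Continuous φ)
    (h : Function.Bijective (K1Unital.map (plusMap φ) (continuous_plusMap φ hφ))) :
    Function.Bijective (K1.map φ hφ) := by
  refine ⟨fun x y hxy => Subtype.ext (h.1 (congrArg Subtype.val hxy)), ?_⟩
  rintro ⟨y, hy⟩
  obtain ⟨x, rfl⟩ := h.2 y
  refine ⟨⟨x, ?_⟩, rfl⟩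
  change K1Unital.map (augmentation B) (continuous_augmentation B)
    (K1Unital.map (plusMap φ) (continuous_plusMap φ hφ) x) = 1 at hy
  rw [K1Unital.map_map] at hy
  simp only [augmentation_comp_plusMap] at hy
  exact hy

/-- A continuous homomorphism that induces isomorphisms on `K₀` and on `K₁`. -/
def IsKEquiv (φ : A →ₙₐ[ℂ] B) (hφ : Continuous φ) : Prop :=
  Function.Bijective (K0.map φ) ∧ Function.Bijective (K1.map φ hφ)

theorem IsKEquiv.of_comp {ψ : B →ₙₐ[ℂ] C} {hψ : Continuous ψ} {φ : A →ₙₐ[ℂ] B} {hφ : Continuous φ}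
    (h : IsKEquiv ψ hψ) (h' : IsKEquiv (ψ.comp φ) (hψ.comp hφ)) : IsKEquiv φ hφ := by
  constructor
  · rw [← Function.Bijective.of_comp_iff' h.1]
    convert h'.1 using 1
    exact funext (K0.map_map ψ φ)
  · rw [← Function.Bijective.of_comp_iff' h.2]
    convert h'.2 using 1
    exact funext (K1.map_map ψ hψ φ hφ)

theorem isKEquiv_of_isFull [CompleteSpace A] [CompleteSpace B] {φ : A →ₙₐ[ℂ] B}
    (h : IsFull φ) (hφ : Continuous φ) : IsKEquiv φ hφ := by
  have : IsLocalHom (plusAlgHom φ) := ⟨(isLocalHom_plusMap h).map_nonunit⟩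
  have hd : DenseRange (plusAlgHom φ) := denseRange_plusMap φ h.denseRange
  have hc : Continuous (plusAlgHom φ) := continuous_plusMap φ hφ
  exact ⟨K0.map_bijective (K0Unital.map_bijective (plusAlgHom φ) hc hd),
    K1.map_bijective hφ (K1Unital.map_bijective (plusAlgHom φ) hc hd)⟩

end NonUnital

end BanachK

section Composition

variable {A B C : Type*} [NonUnitalNormedRing A] [NormedSpace ℂ A] [IsScalarTower ℂ A A]
  [SMulCommClass ℂ A A] [NonUnitalNormedRing B] [NormedSpace ℂ B] [IsScalarTower ℂ B B]
  [SMulCommClass ℂ B B] [NonUnitalNormedRing C] [NormedSpace ℂ C] [IsScalarTower ℂ C C]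
  [SMulCommClass ℂ C C]

theorem IsIsoradial.comp {ψ : B →ₙₐ[ℂ] C} {φ : A →ₙₐ[ℂ] B} (hψ : IsIsoradial ψ)
    (hφ : IsIsoradial φ) : IsIsoradial (ψ.comp φ) where
  norm_map_le a := (hψ.norm_map_le (φ a)).trans (hφ.norm_map_le a)
  radius_map a := (hψ.radius_map (φ a)).trans (hφ.radius_map a)

end Composition

namespace C0BanachAlgebra

variable {X A B : Type*} [TopologicalSpace X] [LocallyCompactSpace X] [T2Space X]
  [NonUnitalNormedRing A] [NormedSpace ℂ A] [IsScalarTower ℂ A A] [SMulCommClass ℂ A A]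
  [CompleteSpace A] [C0BanachAlgebra X A]
  [NonUnitalNormedRing B] [NormedSpace ℂ B] [IsScalarTower ℂ B B] [SMulCommClass ℂ B B]
  [CompleteSpace B] [C0BanachAlgebra X B]

variable (X A) in
theorem isKEquiv_gelfandHom :
    BanachK.IsKEquiv (gelfandHom X A).toNonUnitalAlgHom (gelfandHom X A).continuous :=
  BanachK.isKEquiv_of_isFull (isFull_gelfandHom X A) _

theorem isKEquiv_of_forall_isFull_fibreMap (φ : ContractiveHom X A B)
    (h : ∀ x, IsFull (φ.fibreMap x)) :
    BanachK.IsKEquiv φ.toNonUnitalAlgHom φ.continuous :=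
  have hfull : IsFull ((gelfandHom X B).toNonUnitalAlgHom.comp φ.toNonUnitalAlgHom) :=
    { toIsIsoradial := (isIsoradial_gelfandHom X B).comp
        (isIsoradial_of_forall_fibreMap φ fun x => (h x).toIsIsoradial)
      denseRange := denseRange_gelfandHom_comp φ fun x => (h x).denseRange }
  (isKEquiv_gelfandHom X B).of_comp (BanachK.isKEquiv_of_isFull hfull _)

end C0BanachAlgebra

theorem mainTheorem7_general {X : Type*} [TopologicalSpace X] [LocallyCompactSpace X] [T2Space X] :
    (∀ (A A' : Type*)
        [NonUnitalNormedRing A] [NormedSpace ℂ A] [IsScalarTower ℂ A A] [SMulCommClass ℂ A A]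
        [CompleteSpace A] [C0BanachAlgebra X A]
        [NonUnitalNormedRing A'] [NormedSpace ℂ A'] [IsScalarTower ℂ A' A']
        [SMulCommClass ℂ A' A'] [CompleteSpace A'] [C0BanachAlgebra X A']
        (φ : C0BanachAlgebra.ContractiveHom X A A'),
        (∀ x : X, IsIsoradial (φ.fibreMap x)) →
          IsIsoradial φ.toNonUnitalAlgHom ∧
          ((∀ x : X, DenseRange (φ.fibreMap x)) →
            Function.Bijective (BanachK.K0.map φ.toNonUnitalAlgHom) ∧
            Function.Bijective (BanachK.K1.map φ.toNonUnitalAlgHom φ.continuous))) ∧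
    (∀ (A : Type*)
        [NonUnitalNormedRing A] [NormedSpace ℂ A] [IsScalarTower ℂ A A] [SMulCommClass ℂ A A]
        [CompleteSpace A] [C0BanachAlgebra X A],
        IsFull (C0BanachAlgebra.gelfandHom X A).toNonUnitalAlgHom ∧
        Function.Bijective (BanachK.K0.map (C0BanachAlgebra.gelfandHom X A).toNonUnitalAlgHom) ∧
        Function.Bijective (BanachK.K1.map (C0BanachAlgebra.gelfandHom X A).toNonUnitalAlgHom
          (C0BanachAlgebra.gelfandHom X A).continuous)) := by
  constructor
  · intro A A' _ _ _ _ _ _ _ _ _ _ _ _ φ hφ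
    exact ⟨C0BanachAlgebra.isIsoradial_of_forall_fibreMap φ hφ,
      fun hd => C0BanachAlgebra.isKEquiv_of_forall_isFull_fibreMap φ fun x => ⟨hφ x, hd x⟩⟩
  · intro A _ _ _ _ _ _
    exact ⟨C0BanachAlgebra.isFull_gelfandHom X A, C0BanachAlgebra.isKEquiv_gelfandHom X A⟩

theorem mainTheorem7 {X : Type*} [TopologicalSpace X] [LocallyCompactSpace X] [T2Space X] :
    (SecondCountableTopology X →
      ∀ (A A' : Type*)
        [NonUnitalNormedRing A] [NormedSpace ℂ A] [IsScalarTower ℂ A A] [SMulCommClass ℂ A A]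
        [CompleteSpace A] [C0BanachAlgebra X A]
        [NonUnitalNormedRing A'] [NormedSpace ℂ A'] [IsScalarTower ℂ A' A']
        [SMulCommClass ℂ A' A'] [CompleteSpace A'] [C0BanachAlgebra X A']
        (φ : C0BanachAlgebra.ContractiveHom X A A'),
        (∀ x : X, IsIsoradial (φ.fibreMap x)) →
          IsIsoradial φ.toNonUnitalAlgHom ∧
          ((∀ x : X, DenseRange (φ.fibreMap x)) →
            Function.Bijective (BanachK.K0.map φ.toNonUnitalAlgHom) ∧
            Function.Bijective (BanachK.K1.map φ.toNonUnitalAlgHom φ.continuous))) ∧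
    (∀ (A : Type*)
        [NonUnitalNormedRing A] [NormedSpace ℂ A] [IsScalarTower ℂ A A] [SMulCommClass ℂ A A]
        [CompleteSpace A] [C0BanachAlgebra X A],
        IsFull (C0BanachAlgebra.gelfandHom X A).toNonUnitalAlgHom ∧
        Function.Bijective (BanachK.K0.map (C0BanachAlgebra.gelfandHom X A).toNonUnitalAlgHom) ∧
        Function.Bijective (BanachK.K1.map (C0BanachAlgebra.gelfandHom X A).toNonUnitalAlgHom
          (C0BanachAlgebra.gelfandHom X A).continuous)) := by
  exact ⟨fun _ => mainTheorem7_general.{_, _, _, 0}.1, mainTheorem7_general.{_, 0, 0, _}.2⟩
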